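/- **Setting.** Consider simply typed $\lambda$-terms, up to renaming of bound variables, over base types and typed constants. Each constant $c$ has a set $\mathrm{Ax}(c)\subseteq\{\mathsf A,\mathsf C\}$ of axioms (associativity $f(a,f(b,c))\equiv f(f(a,b),c)$, commutativity $f(a,b)\equiv f(b,a)$), and $\mathrm{Ax}(c)\neq\emptyset$ only if $c$ has a type $\alpha\to\alpha\to\alpha$; $c$ is *free* if $\mathrm{Ax}(c)=\emptyset$. Free (capital) variables, countably many of each type, are kept apart from the bound (lower-case) ones. For $\mathcal E\subseteq\{\mathsf A,\mathsf C\}$, $=_{\mathcal E}$ is the congruence generated by $\beta$, $\eta$ and, for every constant $f$, the axioms in $\mathrm{Ax}(f)\cap\mathcal E$; and $r\preceq_{\mathcal E}t$ means $r\vartheta=_{\mathcal E}t$ for some substitution $\vartheta$. If $\mathsf A\in\mathrm{Ax}(f)$, then $f(t_1,\dots,t_n)$ denotes any nesting of binary applications of $f$ with the arguments $t_1,\dots,t_n$ in this order, where no $t_i$ has itself the form $f(a,b)$; $f(t_1)$ stands for $t_1$. A *higher-order pattern* is a term in whose $\eta$-long $\beta$-normal form every free variable is applied to pairwise distinct ($\eta$-long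 forms of) bound variables. **States and rules.** An anti-unification problem $X(\bar x):t\triangleq s$ consists of a variable $X$, distinct lower-case variables $\bar x$, and terms $t,s$ of one type whose free lower-case variables are among $\bar x$, where $X(\bar x)$ has the type of $t$ and $s$. A state $A;S;\sigma$ consists of two sets $A$, $S$ of such problems and a substitution $\sigma$. In every rule, the variables $Y,Y_i,X'$ are pairwise distinct, of the appropriate types, and fresh for the current state. The rules of $\mathcal G_{base}$ are: * **Dec:** $\{X(\bar x):h(t_1,\dots,t_m)\triangleq h(s_1,\dots,s_m)\}\uplus A;S;\sigma\Longrightarrow\{Y_1(\bar x):t_1\triangleq s_1,\dots,Y_m(\bar x):t_m\triangleq s_m\}\cup A;S;\sigma\{X\mapsto\lambda\bar x.h(Y_1(\bar x),\dots,Y_m(\bar x))\}$, if $h$ is a free constant or $h\in\bar x$. * **Abs:** $\{X(\bar x):\lambda y.t\triangleq\lambda z.s\}\uplus A;S;\sigma\Longrightarrow\{X'(\bar x,y):t\triangleq s\{z\mapsto y\}\}\cup A;S;\sigma\{X\mapsto\lambda\bar x,y.X'(\bar x,y)\}$. * **Sol:** $\{X(\bar x):t\triangleq s\}\uplus A;S;\sigma\Longrightarrow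 A;\{Y(\bar y):t\triangleq s\}\cup S;\sigma\{X\mapsto\lambda\bar x.Y(\bar y)\}$, if $t,s$ have a base type and either their heads differ or both heads are the same capital variable; $\bar y$ is the subsequence of $\bar x$ of the variables that occur freely in $t$ or $s$. * **Mer:** $A;\{X(\bar x):t_1\triangleq t_2,\ Y(\bar y):s_1\triangleq s_2\}\uplus S;\sigma\Longrightarrow A;\{X(\bar x):t_1\triangleq t_2\}\cup S;\sigma\{Y\mapsto\lambda\bar y.X(\bar x\pi)\}$, if $\pi:\{\bar x\}\to\{\bar y\}$ is a type-preserving bijection with $t_1\pi=_{\mathcal E}s_1$ and $t_2\pi=_{\mathcal E}s_2$. An equational decomposition rule replaces, for a constant $f$, a problem $X(\bar x):t\triangleq s$ of $A$ by the two problems $Y_1(\bar x):t'\triangleq s'$ and $Y_2(\bar x):t''\triangleq s''$, and $\sigma$ by $\sigma\{X\mapsto\lambda\bar x.f(Y_1(\bar x),Y_2(\bar x))\}$. The calculi $\mathcal G_{\mathsf A}$, $\mathcal G_{\mathsf C}$, $\mathcal G_{\mathsf{AC}}$ consist of $\mathcal G_{base}$ and, respectively, the following such rules (with $t=f(t_1,\dots,t_n)$,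 $s=f(s_1,\dots,s_m)$, $n,m\ge2$ in the first and the third): * **$\mathcal G_{\mathsf A}$** ($\mathrm{Ax}(f)=\{\mathsf A\}$): either $f(t_1,\dots,t_k)\triangleq s_1$ and $f(t_{k+1},\dots,t_n)\triangleq f(s_2,\dots,s_m)$ with $1\le k\le n-1$; or $t_1\triangleq f(s_1,\dots,s_k)$ and $f(t_2,\dots,t_n)\triangleq f(s_{k+1},\dots,s_m)$ with $1\le k\le m-1$. * **$\mathcal G_{\mathsf C}$** ($\mathrm{Ax}(f)=\{\mathsf C\}$, $t=f(t_1,t_2)$, $s=f(s_1,s_2)$): either $t_1\triangleq s_1$ and $t_2\triangleq s_2$; or $t_1\triangleq s_2$ and $t_2\triangleq s_1$. * **$\mathcal G_{\mathsf{AC}}$** ($\mathrm{Ax}(f)=\{\mathsf A,\mathsf C\}$): either $f(t_{i_1},\dots,t_{i_l})\triangleq s_k$ and $f(t_{i_{l+1}},\dots,t_{i_n})\triangleq f(s_1,\dots,s_{k-1},s_{k+1},\dots,s_m)$, for a permutation $i_1,\dots,i_n$ of $1,\dots,n$, $1\le l\le n-1$ and $1\le k\le m$; or $t_k\triangleq f(s_{i_1},\dots,s_{i_l})$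 and $f(t_1,\dots,t_{k-1},t_{k+1},\dots,t_n)\triangleq f(s_{i_{l+1}},\dots,s_{i_m})$, for a permutation $i_1,\dots,i_m$ of $1,\dots,m$, $1\le l\le m-1$ and $1\le k\le n$. **Theorem (Soundness).** Let $\mathcal G$ be $\mathcal G_{\mathsf A}$, $\mathcal G_{\mathsf C}$ or $\mathcal G_{\mathsf{AC}}$, and let $\mathcal E\subseteq\{\mathsf A,\mathsf C\}$ contain $\{\mathsf A\}$, $\{\mathsf C\}$ or $\{\mathsf A,\mathsf C\}$, respectively. Let $t,s$ be terms of the same type in $\eta$-long $\beta$-normal form, without free lower-case variables, and let $X$ be a variable of this type that occurs neither in $t$ nor in $s$. If $\{X:t\triangleq s\};\emptyset;\emptyset\Longrightarrow^*\emptyset;S;\sigma$ is a transformation sequence of $\mathcal G$ (merging modulo $\mathcal E$), then $X\sigma$ is, after $\beta$-reduction, a higher-order pattern in $\eta$-long $\beta$-normal form, and $X\sigma\preceq_{\mathcal E}t$ and $X\sigma\preceq_{\mathcal E}s$. -/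

import Mathlib

namespace HOAU

universe u v

/-! ### Simple types, signatures, terms -/

/-- Simple types over the base types `B`. -/
inductive Ty (B : Type u) : Type u
  | base : B → Ty B
  | arr : Ty B → Ty B → Ty B

/-- The two axioms a constant may satisfy: associativity and commutativity. -/
inductive Ax : Type
  | assoc
  | comm

/-- A higher-order signature: the constants of each type and the axioms `Ax(c)` of each constant
`c`; only constants of a type `α → α → α` may have axioms. -/
structure Signature (B : Type u) where
  Const : Ty B → Type v
  ax : {τ : Ty B} → Const τ → Set Ax
  ax_type : ∀ {τ : Ty B} (c : Const τ), (ax c).Nonempty → ∃ α : Ty B, τ = .arr α (.arr α α)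

/-- A context: the types of the lower-case variables, the most recent one first. -/
abbrev Ctx (B : Type u) : Type u := List (Ty B)

/-- Typed de Bruijn indices: the lower-case variables. -/
inductive Var {B : Type u} : Ctx B → Ty B → Type u
  | zero {Γ : Ctx B} {α : Ty B} : Var (α :: Γ) α
  | succ {Γ : Ctx B} {α β : Ty B} : Var Γ β → Var (α :: Γ) β

/-- The capital variables: a type together with a name, so countably many for each type. -/
structure MVar (B : Type u) : Type u where
  ty : Ty B
  name : ℕ

/-- Simply typed lambda-terms up to renaming of bound variables. In `Tm S Γ τ` the lower-case
variables that may be free are those of `Γ`; capital variables may occur anywhere. -/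
inductive Tm {B : Type u} (S : Signature.{u, v} B) : Ctx B → Ty B → Type (max u v)
  | bvar {Γ : Ctx B} {τ : Ty B} (x : Var Γ τ) : Tm S Γ τ
  | mvar {Γ : Ctx B} {τ : Ty B} (X : ℕ) : Tm S Γ τ
  | const {Γ : Ctx B} {τ : Ty B} (c : S.Const τ) : Tm S Γ τ
  | lam {Γ : Ctx B} {α β : Ty B} (t : Tm S (α :: Γ) β) : Tm S Γ (.arr α β)
  | app {Γ : Ctx B} {α β : Ty B} (t : Tm S Γ (.arr α β)) (u : Tm S Γ α) : Tm S Γ β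

variable {B : Type u} {S : Signature.{u, v} B}

/-! ### Renaming and substitution of lower-case variables -/

/-- Type-preserving maps between the variables of two contexts. -/
abbrev Ren (Γ Δ : Ctx B) : Type u := ∀ ⦃α : Ty B⦄, Var Γ α → Var Δ α

def Ren.lift {Γ Δ : Ctx B} (ρ : Ren Γ Δ) (β : Ty B) : Ren (β :: Γ) (β :: Δ)
  | _, .zero => .zero
  | _, .succ x => .succ (ρ x)

def Tm.ren {Γ Δ : Ctx B} {τ : Ty B} (ρ : Ren Γ Δ) : Tm S Γ τ → Tm S Δ τ
  | .bvar x => .bvar (ρ x)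
  | .mvar X => .mvar X
  | .const c => .const c
  | .lam (α := α) t => .lam (t.ren (ρ.lift α))
  | .app t u => .app (t.ren ρ) (u.ren ρ)

/-- Weakening by one variable. -/
def Tm.wk {Γ : Ctx B} {τ : Ty B} (β : Ty B) (t : Tm S Γ τ) : Tm S (β :: Γ) τ :=
  t.ren fun _ x => .succ x

/-- The map from the empty context. -/
def Ren.ofNil {Γ : Ctx B} : Ren [] Γ
  | _, x => nomatch x

/-- Weakening of a term without free lower-case variables to an arbitrary context. -/
def Tm.wkNil {Γ : Ctx B} {τ : Ty B} (t : Tm S [] τ) : Tm S Γ τ :=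
  t.ren Ren.ofNil

/-- Assignments of terms to the lower-case variables. -/
abbrev BSub (S : Signature.{u, v} B) (Γ Δ : Ctx B) : Type (max u v) :=
  ∀ ⦃α : Ty B⦄, Var Γ α → Tm S Δ α

def BSub.lift {Γ Δ : Ctx B} (s : BSub S Γ Δ) (β : Ty B) : BSub S (β :: Γ) (β :: Δ)
  | _, .zero => .bvar .zero
  | _, .succ x => (s x).wk β

def Tm.bsub {Γ Δ : Ctx B} {τ : Ty B} (s : BSub S Γ Δ) : Tm S Γ τ → Tm S Δ τ
  | .bvar x => s x
  | .mvar X => .mvar X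
  | .const c => .const c
  | .lam (α := α) t => .lam (t.bsub (s.lift α))
  | .app t u => .app (t.bsub s) (u.bsub s)

/-- The assignment that sends the most recent variable to `u` and fixes the others. -/
def BSub.single {Γ : Ctx B} {β : Ty B} (u : Tm S Γ β) : BSub S (β :: Γ) Γ
  | _, .zero => u
  | _, .succ x => .bvar x

/-- `t.inst u` is `t` with its most recent variable replaced by `u`. -/
def Tm.inst {Γ : Ctx B} {α β : Ty B} (t : Tm S (α :: Γ) β) (u : Tm S Γ α) : Tm S Γ β :=
  t.bsub (BSub.single u)

/-- The lower-case variable `x` occurs freely in the term. -/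
def Tm.Occurs {Γ : Ctx B} {τ α : Ty B} : Tm S Γ τ → Var Γ α → Prop
  | .bvar (τ := τ) y, x => (⟨τ, y⟩ : Σ β : Ty B, Var Γ β) = ⟨α, x⟩
  | .mvar _, _ => False
  | .const _, _ => False
  | .lam t, x => t.Occurs x.succ
  | .app t u, x => t.Occurs x ∨ u.Occurs x

/-- The capital variable `v` occurs in the term. -/
def Tm.MOccurs {Γ : Ctx B} {τ : Ty B} : Tm S Γ τ → MVar B → Prop
  | .bvar _, _ => False
  | .mvar (τ := τ) X, v => (⟨τ, X⟩ : MVar B) = v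
  | .const _, _ => False
  | .lam t, v => t.MOccurs v
  | .app t u, v => t.MOccurs v ∨ u.MOccurs v

/-! ### Beta-reduction and equality modulo a theory -/

/-- One step of beta-reduction, anywhere in the term. -/
inductive Beta : {Γ : Ctx B} → {τ : Ty B} → Tm S Γ τ → Tm S Γ τ → Prop
  | beta {Γ : Ctx B} {α β : Ty B} (t : Tm S (α :: Γ) β) (u : Tm S Γ α) :
      Beta (.app (.lam t) u) (t.inst u)
  | lam {Γ : Ctx B} {α β : Ty B} {t t' : Tm S (α :: Γ) β} :
      Beta t t' → Beta (.lam t) (.lam t')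
  | appL {Γ : Ctx B} {α β : Ty B} {t t' : Tm S Γ (.arr α β)} {u : Tm S Γ α} :
      Beta t t' → Beta (.app t u) (.app t' u)
  | appR {Γ : Ctx B} {α β : Ty B} {t : Tm S Γ (.arr α β)} {u u' : Tm S Γ α} :
      Beta u u' → Beta (.app t u) (.app t u')

/-- The binary application `f(a, b)`. -/
abbrev Tm.bin {Γ : Ctx B} {α : Ty B} (f : S.Const (.arr α (.arr α α))) (a b : Tm S Γ α) :
    Tm S Γ α :=
  .app (.app (.const f) a) b

/-- Equality modulo `E ⊆ {A, C}`: the congruence generated by beta, eta, and, for each constant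
`f`, those of the axioms associativity and commutativity that lie both in `E` and in `Ax(f)`. -/
inductive EqMod (E : Set Ax) : {Γ : Ctx B} → {τ : Ty B} → Tm S Γ τ → Tm S Γ τ → Prop
  | refl {Γ : Ctx B} {τ : Ty B} (t : Tm S Γ τ) : EqMod E t t
  | symm {Γ : Ctx B} {τ : Ty B} {t u : Tm S Γ τ} : EqMod E t u → EqMod E u t
  | trans {Γ : Ctx B} {τ : Ty B} {t u w : Tm S Γ τ} :
      EqMod E t u → EqMod E u w → EqMod E t w
  | lam {Γ : Ctx B} {α β : Ty B} {t t' : Tm S (α :: Γ) β} :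
      EqMod E t t' → EqMod E (.lam t) (.lam t')
  | app {Γ : Ctx B} {α β : Ty B} {t t' : Tm S Γ (.arr α β)} {u u' : Tm S Γ α} :
      EqMod E t t' → EqMod E u u' → EqMod E (.app t u) (.app t' u')
  | beta {Γ : Ctx B} {α β : Ty B} (t : Tm S (α :: Γ) β) (u : Tm S Γ α) :
      EqMod E (.app (.lam t) u) (t.inst u)
  | eta {Γ : Ctx B} {α β : Ty B} (t : Tm S Γ (.arr α β)) :
      EqMod E (.lam (.app (t.wk α) (.bvar .zero))) t
  | assoc {Γ : Ctx B} {α : Ty B} (f : S.Const (.arr α (.arr α α)))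
      (hE : Ax.assoc ∈ E) (hf : Ax.assoc ∈ S.ax f) (a b c : Tm S Γ α) :
      EqMod E (.bin f a (.bin f b c)) (.bin f (.bin f a b) c)
  | comm {Γ : Ctx B} {α : Ty B} (f : S.Const (.arr α (.arr α α)))
      (hE : Ax.comm ∈ E) (hf : Ax.comm ∈ S.ax f) (a b : Tm S Γ α) :
      EqMod E (.bin f a b) (.bin f b a)

/-! ### Eta-long beta-normal forms and higher-order patterns -/

inductive NfKind : Type
  | long
  | neutral

/-- `Nf .long t`: `t` has the form `λ x₁ … xₙ. h(t₁, …, tₘ)` with `h(t₁, …, tₘ)` of a base type,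
`h` a variable or a constant, and all `tᵢ` of this form again.
`Nf .neutral t`: `t` is `h(t₁, …, tₘ)`, of any type, with such `tᵢ`. -/
inductive Nf : NfKind → {Γ : Ctx B} → {τ : Ty B} → Tm S Γ τ → Prop
  | lam {Γ : Ctx B} {α β : Ty B} {t : Tm S (α :: Γ) β} : Nf .long t → Nf .long (.lam t)
  | base {Γ : Ctx B} {b : B} {t : Tm S Γ (.base b)} : Nf .neutral t → Nf .long t
  | bvar {Γ : Ctx B} {τ : Ty B} (x : Var Γ τ) : Nf .neutral (.bvar x : Tm S Γ τ)
  | mvar {Γ : Ctx B} {τ : Ty B} (X : ℕ) : Nf .neutral (.mvar X : Tm S Γ τ)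
  | const {Γ : Ctx B} {τ : Ty B} (c : S.Const τ) : Nf .neutral (.const c : Tm S Γ τ)
  | app {Γ : Ctx B} {α β : Ty B} {t : Tm S Γ (.arr α β)} {u : Tm S Γ α} :
      Nf .neutral t → Nf .long u → Nf .neutral (.app t u)

/-- The term is in eta-long beta-normal form. -/
def Tm.IsLongNormal {Γ : Ctx B} {τ : Ty B} (t : Tm S Γ τ) : Prop := Nf .long t

/-- Eta-expansion of a neutral term; `eta α (.bvar x)` is the eta-long form of `x : α`. -/
def eta {Γ : Ctx B} : (τ : Ty B) → Tm S Γ τ → Tm S Γ τ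
  | .base _, t => t
  | .arr α β, t => .lam (eta β (.app (t.wk α) (eta α (.bvar .zero))))

/-- `FlexApp l t`: `t` is `X(y₁, …, yₖ)` with `X` a capital variable and the `yᵢ` the eta-long
forms of pairwise distinct lower-case variables, listed (in reverse order) in `l`. -/
inductive FlexApp {Γ : Ctx B} : List (Σ α : Ty B, Var Γ α) → {τ : Ty B} → Tm S Γ τ → Prop
  | mvar {τ : Ty B} (X : ℕ) : FlexApp [] (.mvar X : Tm S Γ τ)
  | app {l : List (Σ α : Ty B, Var Γ α)} {α β : Ty B} {t : Tm S Γ (.arr α β)} (x : Var Γ α) :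
      FlexApp l t → (⟨α, x⟩ : Σ α : Ty B, Var Γ α) ∉ l →
      FlexApp (⟨α, x⟩ :: l) (.app t (eta α (.bvar x)))

/-- `Pat .long t`: `t` is an eta-long beta-normal form in which every occurrence of a capital
variable is applied to pairwise distinct (eta-long forms of) lower-case variables.
`Pat .neutral t`: the same for `h(t₁, …, tₘ)`, of any type, with `h` not a capital variable. -/
inductive Pat : NfKind → {Γ : Ctx B} → {τ : Ty B} → Tm S Γ τ → Prop
  | lam {Γ : Ctx B} {α β : Ty B} {t : Tm S (α :: Γ) β} : Pat .long t → Pat .long (.lam t)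
  | flex {Γ : Ctx B} {b : B} {l : List (Σ α : Ty B, Var Γ α)} {t : Tm S Γ (.base b)} :
      FlexApp l t → Pat .long t
  | rigid {Γ : Ctx B} {b : B} {t : Tm S Γ (.base b)} : Pat .neutral t → Pat .long t
  | bvar {Γ : Ctx B} {τ : Ty B} (x : Var Γ τ) : Pat .neutral (.bvar x : Tm S Γ τ)
  | const {Γ : Ctx B} {τ : Ty B} (c : S.Const τ) : Pat .neutral (.const c : Tm S Γ τ)
  | app {Γ : Ctx B} {α β : Ty B} {t : Tm S Γ (.arr α β)} {u : Tm S Γ α} :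
      Pat .neutral t → Pat .long u → Pat .neutral (.app t u)

/-- A higher-order pattern, written in eta-long beta-normal form. All lower-case variables of a
term in the empty context are bound. -/
def Tm.IsPattern {τ : Ty B} (t : Tm S [] τ) : Prop := Pat .long t

/-! ### Substitutions for capital variables -/

abbrev Subst (S : Signature.{u, v} B) : Type (max u v) := (w : MVar B) → Tm S [] w.ty

/-- The empty substitution. -/
def Subst.id : Subst S := fun w => .mvar w.name

def Subst.Dom (σ : Subst S) : Set (MVar B) := {w | σ w ≠ .mvar w.name}

/-- `tσ`. There is no capture, since the terms `σ w` have no free lower-case variables. -/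
def Tm.msub {Γ : Ctx B} {τ : Ty B} (σ : Subst S) : Tm S Γ τ → Tm S Γ τ
  | .bvar x => .bvar x
  | .mvar (τ := τ) X => (σ ⟨τ, X⟩).wkNil
  | .const c => .const c
  | .lam t => .lam (t.msub σ)
  | .app t u => .app (t.msub σ) (u.msub σ)

open Classical in
/-- `σ{X ↦ p}`, the composition of `σ` with the substitution `{X ↦ p}`. -/
noncomputable def Subst.extend (σ : Subst S) {τ : Ty B} (X : ℕ) (p : Tm S [] τ) : Subst S :=
  fun w => (σ w).msub (Function.update Subst.id ⟨τ, X⟩ p)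

/-- `r ⪯_E t`: some substitution (with finite domain) sends `r` to `t` modulo `E`. -/
def MoreGeneral (E : Set Ax) {τ : Ty B} (r t : Tm S [] τ) : Prop :=
  ∃ θ : Subst S, θ.Dom.Finite ∧ EqMod E (r.msub θ) t

/-! ### Anti-unification problems and states -/

/-- The type `γ₁ → … → γₙ → τ` of `λ x₁ … xₙ. t` for `t : τ` in the context of `x₁ … xₙ`. -/
def arrows : Ctx B → Ty B → Ty B
  | [], τ => τ
  | α :: Γ, τ => arrows Γ (.arr α τ)

/-- `λ x₁ … xₙ. t`. -/
def lams : {Γ : Ctx B} → {τ : Ty B} → Tm S Γ τ → Tm S [] (arrows Γ τ)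
  | [], _, t => t
  | _ :: Γ, _, t => lams (Γ := Γ) (.lam t)

/-- `t(x₁ρ, …, xₙρ)`, where `x₁, …, xₙ` are the variables of `Γ` and the arguments are written in
eta-long form. -/
def appVars : (Γ : Ctx B) → {Δ : Ctx B} → {τ : Ty B} → Ren Γ Δ →
    Tm S Δ (arrows Γ τ) → Tm S Δ τ
  | [], _, _, _, t => t
  | α :: Γ, _, τ, ρ, t =>
      .app (appVars Γ (τ := .arr α τ) (fun _ x => ρ (.succ x)) t) (eta α (.bvar (ρ .zero)))

/-- The generalization term `X(x₁, …, xₙ)`, with `x₁, …, xₙ` the variables of the context. -/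
def genTerm {Γ : Ctx B} {τ : Ty B} (X : ℕ) : Tm S Γ τ :=
  appVars Γ (fun _ x => x) (.mvar X)

/-- An anti-unification problem `X(x₁, …, xₙ) : t ≜ s`; the context lists the types of
`x₁, …, xₙ`. -/
structure AUP (S : Signature.{u, v} B) : Type (max u v) where
  ctx : Ctx B
  ty : Ty B
  name : ℕ
  lhs : Tm S ctx ty
  rhs : Tm S ctx ty

/-- The generalization variable. -/
def AUP.var (P : AUP S) : MVar B := ⟨arrows P.ctx P.ty, P.name⟩

/-- `X(x₁, …, xₙ) : t ≜ s`. -/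
abbrev aup {Γ : Ctx B} {τ : Ty B} (X : ℕ) (t s : Tm S Γ τ) : AUP S := ⟨Γ, τ, X, t, s⟩

/-- A state `A; S; σ`. -/
structure State (S : Signature.{u, v} B) : Type (max u v) where
  active : Set (AUP S)
  store : Set (AUP S)
  sub : Subst S

/-- The variable `w` is fresh for a state: it occurs neither in its problems nor in its
substitution. -/
def State.Fresh (st : State S) (w : MVar B) : Prop :=
  (∀ P ∈ st.active ∪ st.store, P.var ≠ w ∧ ¬ P.lhs.MOccurs w ∧ ¬ P.rhs.MOccurs w) ∧
  w ∉ st.sub.Dom ∧ ∀ w' ∈ st.sub.Dom, ¬ (st.sub w').MOccurs w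

/-! ### Auxiliary notions for the rules -/

/-- Heads of terms. -/
inductive Head (S : Signature.{u, v} B) (Γ : Ctx B) : Type (max u v)
  | bvar {τ : Ty B} (x : Var Γ τ)
  | mvar (X : MVar B)
  | const {τ : Ty B} (c : S.Const τ)

/-- The head of a term `h(t₁, …, tₘ)`. -/
def Tm.head? {Γ : Ctx B} {τ : Ty B} : Tm S Γ τ → Option (Head S Γ)
  | .bvar x => some (.bvar x)
  | .mvar (τ := τ) X => some (.mvar ⟨τ, X⟩)
  | .const c => some (.const c)
  | .lam _ => none
  | .app t _ => t.head?

/-- Order-preserving embeddings: `Δ` is a subsequence of `Γ`. -/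
inductive Sub {B : Type u} : Ctx B → Ctx B → Type u
  | nil : Sub [] []
  | skip {Δ Γ : Ctx B} {α : Ty B} : Sub Δ Γ → Sub Δ (α :: Γ)
  | keep {Δ Γ : Ctx B} {α : Ty B} : Sub Δ Γ → Sub (α :: Δ) (α :: Γ)

def Sub.ren : {Δ Γ : Ctx B} → Sub Δ Γ → Ren Δ Γ
  | _, _, .nil => fun _ x => x
  | _, _, .skip e => fun _ x => .succ (e.ren x)
  | _, _, .keep e => e.ren.lift _

/-- `DecArgs t s g L`: `t = h(t₁, …, tₘ)` and `s = h(s₁, …, sₘ)`, where `h` is a free constant or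
one of the variables `x₁, …, xₙ` of the context, `g = h(Y₁(x₁, …, xₙ), …, Yₘ(x₁, …, xₙ))`, and `L`
consists of the problems `Yᵢ(x₁, …, xₙ) : tᵢ ≜ sᵢ`. -/
inductive DecArgs {Γ : Ctx B} :
    {τ : Ty B} → Tm S Γ τ → Tm S Γ τ → Tm S Γ τ → List (AUP S) → Prop
  | bvar {τ : Ty B} (x : Var Γ τ) : DecArgs (.bvar x) (.bvar x) (.bvar x) []
  | const {τ : Ty B} (c : S.Const τ) (hc : S.ax c = ∅) :
      DecArgs (.const c) (.const c) (.const c) []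
  | app {α β : Ty B} {t s g : Tm S Γ (.arr α β)} {L : List (AUP S)} (t' s' : Tm S Γ α) (Y : ℕ) :
      DecArgs t s g L →
      DecArgs (.app t t') (.app s s') (.app g (genTerm Y)) (aup Y t' s' :: L)

/-- `Flat f l t`: the flattened form of `t` with respect to `f` is `f(l)`, that is, `t` arises from
the list `l` of terms not of the form `f(a, b)` by some bracketing with `f`. A one-element list
stands for its element. -/
inductive Flat {Γ : Ctx B} {α : Ty B} (f : S.Const (.arr α (.arr α α))) :
    List (Tm S Γ α) → Tm S Γ α → Prop
  | leaf (t : Tm S Γ α) : (∀ a b : Tm S Γ α, t ≠ .bin f a b) → Flat f [t] t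
  | node {l l' : List (Tm S Γ α)} {t t' : Tm S Γ α} :
      Flat f l t → Flat f l' t' → Flat f (l ++ l') (.bin f t t')

/-! ### The rules -/

/-- The names of the three calculi: the base rules together with the decomposition rules for
associative, for commutative, or for associative-commutative constants. -/
inductive Calculus : Type
  | A
  | C
  | AC

def Calculus.theory : Calculus → Set Ax
  | .A => {.assoc}
  | .C => {.comm}
  | .AC => {.assoc, .comm}

/-- `BinDec 𝒢 f t s t₁ s₁ t₂ s₂`: the equational decomposition rules of `𝒢` for the constant `f`
replace a problem `X(x₁, …, xₙ) : t ≜ s` by two problems with the sides `t₁ ≜ s₁` and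
`t₂ ≜ s₂`. -/
inductive BinDec {Γ : Ctx B} {α : Ty B} (f : S.Const (.arr α (.arr α α))) :
    Calculus → (t s t₁ s₁ t₂ s₂ : Tm S Γ α) → Prop
  | decAL {l₁ l₂ r₂ : List (Tm S Γ α)} {t s t₁ s₁ t₂ s₂ : Tm S Γ α} :
      S.ax f = {.assoc} → l₁ ≠ [] → l₂ ≠ [] → r₂ ≠ [] →
      Flat f (l₁ ++ l₂) t → Flat f (s₁ :: r₂) s →
      Flat f l₁ t₁ → Flat f l₂ t₂ → Flat f r₂ s₂ →
      BinDec f .A t s t₁ s₁ t₂ s₂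
  | decAR {l₂ r₁ r₂ : List (Tm S Γ α)} {t s t₁ s₁ t₂ s₂ : Tm S Γ α} :
      S.ax f = {.assoc} → r₁ ≠ [] → r₂ ≠ [] → l₂ ≠ [] →
      Flat f (t₁ :: l₂) t → Flat f (r₁ ++ r₂) s →
      Flat f r₁ s₁ → Flat f l₂ t₂ → Flat f r₂ s₂ →
      BinDec f .A t s t₁ s₁ t₂ s₂
  | decC {t₁ t₂ s₁ s₂ : Tm S Γ α} :
      S.ax f = {.comm} → BinDec f .C (.bin f t₁ t₂) (.bin f s₁ s₂) t₁ s₁ t₂ s₂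
  | decCSwap {t₁ t₂ s₁ s₂ : Tm S Γ α} :
      S.ax f = {.comm} → BinDec f .C (.bin f t₁ t₂) (.bin f s₁ s₂) t₁ s₂ t₂ s₁
  | decACL {l l₁ l₂ p q : List (Tm S Γ α)} {t s t₁ s₁ t₂ s₂ : Tm S Γ α} :
      S.ax f = {.assoc, .comm} → l₁ ≠ [] → l₂ ≠ [] → p ++ q ≠ [] → l.Perm (l₁ ++ l₂) →
      Flat f l t → Flat f (p ++ s₁ :: q) s →
      Flat f l₁ t₁ → Flat f l₂ t₂ → Flat f (p ++ q) s₂ →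
      BinDec f .AC t s t₁ s₁ t₂ s₂
  | decACR {r r₁ r₂ p q : List (Tm S Γ α)} {t s t₁ s₁ t₂ s₂ : Tm S Γ α} :
      S.ax f = {.assoc, .comm} → r₁ ≠ [] → r₂ ≠ [] → p ++ q ≠ [] → r.Perm (r₁ ++ r₂) →
      Flat f (p ++ t₁ :: q) t → Flat f r s →
      Flat f r₁ s₁ → Flat f (p ++ q) t₂ → Flat f r₂ s₂ →
      BinDec f .AC t s t₁ s₁ t₂ s₂

/-- One transformation step of the calculus `𝒢`, with merging modulo `E`. -/
inductive Step (𝒢 : Calculus) (E : Set Ax) : State S → State S → Prop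
  | dec {A R : Set (AUP S)} {σ : Subst S} {Γ : Ctx B} {τ : Ty B} {X : ℕ} {t s g : Tm S Γ τ}
      {L : List (AUP S)} :
      aup X t s ∉ A → DecArgs t s g L → (L.map AUP.var).Nodup →
      (∀ P ∈ L, State.Fresh ⟨insert (aup X t s) A, R, σ⟩ P.var) →
      Step 𝒢 E ⟨insert (aup X t s) A, R, σ⟩ ⟨{P | P ∈ L} ∪ A, R, σ.extend X (lams g)⟩
  | abs {A R : Set (AUP S)} {σ : Subst S} {Γ : Ctx B} {α β : Ty B} {X X' : ℕ}
      {t s : Tm S (α :: Γ) β} :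
      aup X (.lam t) (.lam s) ∉ A →
      State.Fresh ⟨insert (aup X (.lam t) (.lam s)) A, R, σ⟩ (aup X' t s).var →
      Step 𝒢 E ⟨insert (aup X (.lam t) (.lam s)) A, R, σ⟩
        ⟨insert (aup X' t s) A, R,
          σ.extend X (lams (genTerm X' : Tm S (α :: Γ) β))⟩
  | sol {A R : Set (AUP S)} {σ : Subst S} {Γ Δ : Ctx B} {b : B} {X Y : ℕ}
      {t s : Tm S Γ (.base b)} {t' s' : Tm S Δ (.base b)} (e : Sub Δ Γ) {h h' : Head S Γ} :
      aup X t s ∉ A → t.head? = some h → s.head? = some h' →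
      (h ≠ h' ∨ ∃ Z : MVar B, h = .mvar Z ∧ h' = .mvar Z) →
      t = t'.ren e.ren → s = s'.ren e.ren →
      (∀ (α : Ty B) (x : Var Δ α), t'.Occurs x ∨ s'.Occurs x) →
      State.Fresh ⟨insert (aup X t s) A, R, σ⟩ (aup Y t' s').var →
      Step 𝒢 E ⟨insert (aup X t s) A, R, σ⟩
        ⟨A, insert (aup Y t' s') R,
          σ.extend X (lams (appVars Δ e.ren (.mvar Y) : Tm S Γ (.base b)))⟩
  | mer {A R : Set (AUP S)} {σ : Subst S} {Γ Δ : Ctx B} {τ : Ty B} {X Y : ℕ}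
      {t₁ t₂ : Tm S Γ τ} {s₁ s₂ : Tm S Δ τ} (π : Ren Γ Δ) :
      aup X t₁ t₂ ≠ aup Y s₁ s₂ → aup X t₁ t₂ ∉ R → aup Y s₁ s₂ ∉ R →
      (∀ α : Ty B, Function.Bijective (π (α := α))) →
      EqMod E (t₁.ren π) s₁ → EqMod E (t₂.ren π) s₂ →
      Step 𝒢 E ⟨A, insert (aup X t₁ t₂) (insert (aup Y s₁ s₂) R), σ⟩
        ⟨A, insert (aup X t₁ t₂) R,
          σ.extend Y (lams (appVars Γ π (.mvar X) : Tm S Δ τ))⟩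
  | eqDec {A R : Set (AUP S)} {σ : Subst S} {Γ : Ctx B} {α : Ty B} {X Y₁ Y₂ : ℕ}
      {t s t₁ s₁ t₂ s₂ : Tm S Γ α} (f : S.Const (.arr α (.arr α α))) :
      aup X t s ∉ A → BinDec f 𝒢 t s t₁ s₁ t₂ s₂ →
      (aup Y₁ t₁ s₁).var ≠ (aup Y₂ t₂ s₂).var →
      State.Fresh ⟨insert (aup X t s) A, R, σ⟩ (aup Y₁ t₁ s₁).var →
      State.Fresh ⟨insert (aup X t s) A, R, σ⟩ (aup Y₂ t₂ s₂).var →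
      Step 𝒢 E ⟨insert (aup X t s) A, R, σ⟩
        ⟨{aup Y₁ t₁ s₁, aup Y₂ t₂ s₂} ∪ A, R,
          σ.extend X (lams (.bin f (genTerm Y₁) (genTerm Y₂) : Tm S Γ α))⟩

end HOAU

/-!
Every transformation step replaces the generalization variable of one problem `P` by a closed term
`p` built from the variables of the problems that succeed `P`. The proof therefore follows the
effect of arbitrary values: with `Q P q` standing for "`q` is a good value for the variable of
`P`", the property

  for all `θ`, if `Q P (θ P.var)` for all problems `P` of the state `A; S; σ`, then
  `Q P₀ ((σ P₀.var)θ)` for the initial problem `P₀`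

holds of the initial state, and it is kept by a step as soon as `p` under `θ` is good for the
replaced problem whenever the values of its successors are good (`extend_spec`,
`Invariant.step`, `Step.invariant`). No intermediate form of `X₀σ` has to be described.

Three notions of a good value for `X(x₁, …, xₙ) : t ≜ s` are used: `q(x₁, …, xₙ)` equals `t`
modulo `E`, the same for `s` (`IsValue`), and `q(y₁, …, yₙ)` beta-reduces to an eta-long pattern
for all distinct variables `yᵢ` (`IsPatternFun`). In a final state `∅; S; σ` the assignment of
`λ x₁ … xₙ. t` to the variable of each stored problem gives the instance `t` of `X₀σ`, that of
`λ x₁ … xₙ. s` gives the instance `s`, and the identity gives the pattern, since a stored variable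
`Y` has base type when applied to all its arguments, so `Y(y₁, …, yₙ)` is itself a pattern.

Arguments are always written as eta-long forms of variables, so the beta-steps that evaluate
`(λ x₁ … xₙ. g)(y₁, …, yₙ)` substitute eta-long variables for variables. On eta-long terms
further beta-reduction turns this into a mere renaming (`EtaSub.red`); this is proved together
with the fact that the eta-expansion of an eta-long term reduces back to it (`Nf.red_eta`), by
induction on types. For the equational rules, all bracketings of a list agree modulo
associativity, and all bracketings of its rearrangements agree modulo both axioms
(`Flat.eqMod`, `Flat.eqMod_perm`).
-/

namespace HOAU

universe u v

variable {B : Type u} {S : Signature.{u, v} B}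

/-! ### The calculus of renamings and substitutions -/

theorem Ren.lift_comp {Γ Δ Θ : Ctx B} (ρ : Ren Γ Δ) (ρ' : Ren Δ Θ) (β : Ty B) :
    (fun _ x => (ρ'.lift β) ((ρ.lift β) x) : Ren (β :: Γ) (β :: Θ)) =
      Ren.lift (fun _ x => ρ' (ρ x)) β := by
  funext α x
  cases x <;> rfl

theorem Ren.lift_id {Γ : Ctx B} (β : Ty B) :
    Ren.lift (fun _ x => x : Ren Γ Γ) β = fun _ x => x := by
  funext α x
  cases x <;> rfl

theorem Ren.eq_of_nil {Γ : Ctx B} (ρ ρ' : Ren [] Γ) : ρ = ρ' := by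
  funext α x
  cases x

theorem Tm.ren_ren {Γ Δ Θ : Ctx B} {τ : Ty B} (t : Tm S Γ τ) (ρ : Ren Γ Δ) (ρ' : Ren Δ Θ) :
    (t.ren ρ).ren ρ' = t.ren fun _ x => ρ' (ρ x) := by
  induction t generalizing Δ Θ with
  | lam t ih => simp only [Tm.ren, ih, Ren.lift_comp]
  | app t u iht ihu => simp only [Tm.ren, iht, ihu]
  | _ => rfl

theorem Tm.ren_id {Γ : Ctx B} {τ : Ty B} (t : Tm S Γ τ) : (t.ren fun _ x => x) = t := by
  induction t with
  | lam t ih => simp only [Tm.ren, Ren.lift_id, ih]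
  | app t u iht ihu => simp only [Tm.ren, iht, ihu]
  | _ => rfl

theorem BSub.lift_ren {Γ Δ Θ : Ctx B} (ρ : Ren Γ Δ) (s : BSub S Δ Θ) (β : Ty B) :
    (fun _ x => (s.lift β) ((ρ.lift β) x) : BSub S (β :: Γ) (β :: Θ)) =
      BSub.lift (fun _ x => s (ρ x)) β := by
  funext α x
  cases x <;> rfl

theorem Tm.bsub_ren {Γ Δ Θ : Ctx B} {τ : Ty B} (t : Tm S Γ τ) (ρ : Ren Γ Δ)
    (s : BSub S Δ Θ) : (t.ren ρ).bsub s = t.bsub fun _ x => s (ρ x) := by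
  induction t generalizing Δ Θ with
  | lam t ih => simp only [Tm.ren, Tm.bsub, ih, BSub.lift_ren]
  | app t u iht ihu => simp only [Tm.ren, Tm.bsub, iht, ihu]
  | _ => rfl

theorem Tm.wk_ren {Γ Δ : Ctx B} {τ : Ty B} (t : Tm S Γ τ) (ρ : Ren Γ Δ) (β : Ty B) :
    (t.wk β).ren (ρ.lift β) = (t.ren ρ).wk β := by
  simp only [Tm.wk, Tm.ren_ren, Ren.lift]

theorem BSub.ren_lift {Γ Δ Θ : Ctx B} (s : BSub S Γ Δ) (ρ : Ren Δ Θ) (β : Ty B) :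
    (fun _ x => ((s.lift β) x).ren (ρ.lift β) : BSub S (β :: Γ) (β :: Θ)) =
      BSub.lift (fun _ x => (s x).ren ρ) β := by
  funext α x
  cases x with
  | zero => rfl
  | succ x => exact Tm.wk_ren _ _ _

theorem Tm.ren_bsub {Γ Δ Θ : Ctx B} {τ : Ty B} (t : Tm S Γ τ) (s : BSub S Γ Δ)
    (ρ : Ren Δ Θ) : (t.bsub s).ren ρ = t.bsub fun _ x => (s x).ren ρ := by
  induction t generalizing Δ Θ with
  | lam t ih => simp only [Tm.ren, Tm.bsub, ih, BSub.ren_lift]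
  | app t u iht ihu => simp only [Tm.ren, Tm.bsub, iht, ihu]
  | _ => rfl

theorem Tm.wk_bsub {Γ Δ : Ctx B} {τ : Ty B} (t : Tm S Γ τ) (s : BSub S Γ Δ) (β : Ty B) :
    (t.wk β).bsub (s.lift β) = (t.bsub s).wk β := by
  simp only [Tm.wk, Tm.bsub_ren, Tm.ren_bsub, BSub.lift]

theorem BSub.lift_comp {Γ Δ Θ : Ctx B} (s : BSub S Γ Δ) (s' : BSub S Δ Θ) (β : Ty B) :
    (fun _ x => ((s.lift β) x).bsub (s'.lift β) : BSub S (β :: Γ) (β :: Θ)) =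
      BSub.lift (fun _ x => (s x).bsub s') β := by
  funext α x
  cases x with
  | zero => rfl
  | succ x => exact Tm.wk_bsub _ _ _

theorem Tm.bsub_bsub {Γ Δ Θ : Ctx B} {τ : Ty B} (t : Tm S Γ τ) (s : BSub S Γ Δ)
    (s' : BSub S Δ Θ) : (t.bsub s).bsub s' = t.bsub fun _ x => (s x).bsub s' := by
  induction t generalizing Δ Θ with
  | lam t ih => simp only [Tm.bsub, ih, BSub.lift_comp]
  | app t u iht ihu => simp only [Tm.bsub, iht, ihu]
  | _ => rfl

theorem BSub.lift_bvar {Γ Δ : Ctx B} (ρ : Ren Γ Δ) (β : Ty B) :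
    BSub.lift (fun _ x => .bvar (ρ x) : BSub S Γ Δ) β = fun _ x => .bvar ((ρ.lift β) x) := by
  funext α x
  cases x <;> rfl

theorem Tm.bsub_bvar {Γ Δ : Ctx B} {τ : Ty B} (t : Tm S Γ τ) (ρ : Ren Γ Δ) :
    (t.bsub fun _ x => .bvar (ρ x)) = t.ren ρ := by
  induction t generalizing Δ with
  | lam t ih => simp only [Tm.ren, Tm.bsub, BSub.lift_bvar, ih]
  | app t u iht ihu => simp only [Tm.ren, Tm.bsub, iht, ihu]
  | _ => rfl

theorem Tm.wk_inst {Γ : Ctx B} {α τ : Ty B} (t : Tm S Γ τ) (u : Tm S Γ α) :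
    (t.wk α).inst u = t := by
  simp only [Tm.wk, Tm.inst, Tm.bsub_ren, BSub.single]
  exact (t.bsub_bvar fun _ x => x).trans t.ren_id

/-- A term without free lower-case variables is not affected by assignments to them. -/
theorem Tm.bsub_wkNil {Γ Δ : Ctx B} {τ : Ty B} (t : Tm S [] τ) (s : BSub S Γ Δ) :
    (t.wkNil).bsub s = t.wkNil := by
  unfold Tm.wkNil
  rw [Tm.bsub_ren, ← Tm.bsub_bvar]
  congr 1
  funext α x
  cases x

theorem Tm.ren_wkNil {Γ Δ : Ctx B} {τ : Ty B} (t : Tm S [] τ) (ρ : Ren Γ Δ) :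
    (t.wkNil).ren ρ = t.wkNil := by
  unfold Tm.wkNil
  rw [Tm.ren_ren]
  congr 1
  exact Ren.eq_of_nil _ _

theorem Tm.ren_nil {τ : Ty B} (t : Tm S [] τ) (ρ : Ren [] []) : t.ren ρ = t := by
  rw [Ren.eq_of_nil ρ fun _ x => x, Tm.ren_id]

theorem Tm.inst_ren {Γ Δ : Ctx B} {α τ : Ty B} (t : Tm S (α :: Γ) τ) (u : Tm S Γ α)
    (ρ : Ren Γ Δ) : (t.inst u).ren ρ = (t.ren (ρ.lift α)).inst (u.ren ρ) := by
  unfold Tm.inst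
  rw [Tm.ren_bsub, Tm.bsub_ren]
  congr 1
  funext β x
  cases x <;> rfl

/-- Extending an assignment by a value for one more variable, as a composition. -/
theorem Tm.bsub_lift_inst {Γ Δ : Ctx B} {α τ : Ty B} (t : Tm S (α :: Γ) τ) (u : Tm S Δ α)
    (s : BSub S (α :: Γ) Δ) (h : s .zero = u) :
    (t.bsub (BSub.lift (fun _ x => s (.succ x)) α)).inst u = t.bsub s := by
  unfold Tm.inst
  rw [Tm.bsub_bsub]
  congr 1
  funext β x
  cases x with
  | zero => exact h.symm
  | succ x => exact Tm.wk_inst _ _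

/-! ### Substitution for capital variables -/

theorem Tm.ren_msub {Γ Δ : Ctx B} {τ : Ty B} (t : Tm S Γ τ) (ρ : Ren Γ Δ) (θ : Subst S) :
    (t.ren ρ).msub θ = (t.msub θ).ren ρ := by
  induction t generalizing Δ with
  | lam t ih => simp only [Tm.ren, Tm.msub, ih]
  | app t u iht ihu => simp only [Tm.ren, Tm.msub, iht, ihu]
  | mvar X => exact (Tm.ren_wkNil _ _).symm
  | _ => rfl

theorem Tm.msub_msub {Γ : Ctx B} {τ : Ty B} (t : Tm S Γ τ) (σ θ : Subst S) :
    (t.msub σ).msub θ = t.msub fun w => (σ w).msub θ := by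
  induction t with
  | lam t ih => simp only [Tm.msub, ih]
  | app t u iht ihu => simp only [Tm.msub, iht, ihu]
  | mvar X => exact Tm.ren_msub _ _ _
  | _ => rfl

theorem Tm.msub_id {Γ : Ctx B} {τ : Ty B} (t : Tm S Γ τ) : t.msub Subst.id = t := by
  induction t with
  | lam t ih => simp only [Tm.msub, ih]
  | app t u iht ihu => simp only [Tm.msub, iht, ihu]
  | _ => rfl

theorem lams_msub {Γ : Ctx B} {τ : Ty B} (t : Tm S Γ τ) (θ : Subst S) :
    (lams t).msub θ = lams (t.msub θ) := by
  induction Γ generalizing τ with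
  | nil => rfl
  | cons α Γ ih => exact ih (.lam t)

/-! ### Eta-expansion and substitution -/

theorem eta_bsub {Γ Δ : Ctx B} {τ : Ty B} (t : Tm S Γ τ) (s : BSub S Γ Δ) :
    (eta τ t).bsub s = eta τ (t.bsub s) := by
  induction τ generalizing Γ Δ with
  | base b => rfl
  | arr α β ihα ihβ => simp only [eta, Tm.bsub, ihα, ihβ, Tm.wk_bsub, BSub.lift]

theorem eta_ren {Γ Δ : Ctx B} {τ : Ty B} (t : Tm S Γ τ) (ρ : Ren Γ Δ) :
    (eta τ t).ren ρ = eta τ (t.ren ρ) := by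
  rw [← Tm.bsub_bvar, eta_bsub, Tm.bsub_bvar]

theorem eta_msub {Γ : Ctx B} {τ : Ty B} (t : Tm S Γ τ) (θ : Subst S) :
    (eta τ t).msub θ = eta τ (t.msub θ) := by
  induction τ generalizing Γ with
  | base b => rfl
  | arr α β ihα ihβ => simp only [eta, Tm.msub, ihα, ihβ, Tm.wk, Tm.ren_msub]

theorem appVars_msub {Γ Δ : Ctx B} {τ : Ty B} (ρ : Ren Γ Δ) (t : Tm S Δ (arrows Γ τ))
    (θ : Subst S) : (appVars Γ ρ t).msub θ = appVars Γ ρ (t.msub θ) := by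
  induction Γ generalizing τ with
  | nil => rfl
  | cons α Γ ih =>
    exact congrArg₂ Tm.app (ih (τ := .arr α τ) _ t) (eta_msub _ θ)

/-! ### Beta-reduction and equality modulo a theory under renaming -/

/-- Beta-reduction in any number of steps. -/
abbrev Red {Γ : Ctx B} {τ : Ty B} (t u : Tm S Γ τ) : Prop := Relation.ReflTransGen Beta t u

theorem Beta.ren {Γ Δ : Ctx B} {τ : Ty B} {t u : Tm S Γ τ} (h : Beta t u) (ρ : Ren Γ Δ) :
    Beta (t.ren ρ) (u.ren ρ) := by
  induction h generalizing Δ with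
  | beta t u => rw [Tm.inst_ren]; exact .beta _ _
  | lam _ ih => exact .lam (ih _)
  | appL _ ih => exact .appL (ih _)
  | appR _ ih => exact .appR (ih _)

theorem Red.ren {Γ Δ : Ctx B} {τ : Ty B} {t u : Tm S Γ τ} (h : Red t u) (ρ : Ren Γ Δ) :
    Red (t.ren ρ) (u.ren ρ) :=
  Relation.ReflTransGen.lift (Tm.ren ρ) (fun _ _ h => Beta.ren h ρ) _ _ h

theorem Red.lam {Γ : Ctx B} {α β : Ty B} {t u : Tm S (α :: Γ) β} (h : Red t u) :
    Red (.lam t) (.lam u) :=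
  Relation.ReflTransGen.lift Tm.lam (fun _ _ => Beta.lam) _ _ h

theorem Red.app {Γ : Ctx B} {α β : Ty B} {t t' : Tm S Γ (.arr α β)} {u u' : Tm S Γ α}
    (h : Red t t') (h' : Red u u') : Red (.app t u) (.app t' u') :=
  (Relation.ReflTransGen.lift (fun x => Tm.app x u) (fun _ _ => Beta.appL) _ _ h).trans
    (Relation.ReflTransGen.lift (Tm.app t') (fun _ _ => Beta.appR) _ _ h')

theorem Red.eta {Γ : Ctx B} {τ : Ty B} {t u : Tm S Γ τ} (h : Red t u) :
    Red (eta τ t) (eta τ u) := by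
  induction τ generalizing Γ with
  | base b => exact h
  | arr α β _ ihβ => exact (ihβ ((h.ren _).app .refl)).lam

theorem EqMod.of_beta {E : Set Ax} {Γ : Ctx B} {τ : Ty B} {t u : Tm S Γ τ} (h : Beta t u) :
    EqMod E t u := by
  induction h with
  | beta t u => exact .beta t u
  | lam _ ih => exact .lam ih
  | appL _ ih => exact .app ih (.refl _)
  | appR _ ih => exact .app (.refl _) ih

theorem EqMod.of_red {E : Set Ax} {Γ : Ctx B} {τ : Ty B} {t u : Tm S Γ τ} (h : Red t u) :
    EqMod E t u := by
  induction h with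
  | refl => exact .refl _
  | tail _ h ih => exact ih.trans (.of_beta h)

theorem EqMod.ren {E : Set Ax} {Γ Δ : Ctx B} {τ : Ty B} {t u : Tm S Γ τ} (h : EqMod E t u)
    (ρ : Ren Γ Δ) : EqMod E (t.ren ρ) (u.ren ρ) := by
  induction h generalizing Δ with
  | refl => exact .refl _
  | symm _ ih => exact (ih ρ).symm
  | trans _ _ ih ih' => exact (ih ρ).trans (ih' ρ)
  | lam _ ih => exact .lam (ih _)
  | app _ _ ih ih' => exact .app (ih ρ) (ih' ρ)
  | beta t u => rw [Tm.inst_ren]; exact .beta _ _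
  | eta t =>
    have := EqMod.eta (E := E) (t.ren ρ)
    rwa [← Tm.wk_ren] at this
  | assoc f hE hf a b c => exact .assoc f hE hf _ _ _
  | comm f hE hf a b => exact .comm f hE hf _ _

theorem EqMod.eta_long {E : Set Ax} {Γ : Ctx B} {τ : Ty B} (t : Tm S Γ τ) :
    EqMod E (HOAU.eta τ t) t := by
  induction τ generalizing Γ with
  | base b => exact .refl _
  | arr α β ihα ihβ =>
    exact (EqMod.lam ((ihβ _).trans (.app (.refl _) (ihα _)))).trans (.eta t)

/-! ### Eta-long normal forms -/

theorem Nf.of_lam {Γ : Ctx B} {α β : Ty B} {t : Tm S (α :: Γ) β} (h : Nf .long (.lam t)) :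
    Nf .long t := by
  cases h with
  | lam h => exact h

theorem Nf.of_base {Γ : Ctx B} {b : B} {t : Tm S Γ (.base b)} (h : Nf .long t) :
    Nf .neutral t := by
  cases h with
  | base h => exact h

theorem Nf.of_app {Γ : Ctx B} {α β : Ty B} {t : Tm S Γ (.arr α β)} {u : Tm S Γ α}
    (h : Nf .neutral (.app t u)) : Nf .neutral t ∧ Nf .long u := by
  cases h with
  | app h h' => exact ⟨h, h'⟩

theorem Nf.exists_lam {Γ : Ctx B} {α β : Ty B} {t : Tm S Γ (.arr α β)} (h : Nf .long t) :
    ∃ u : Tm S (α :: Γ) β, t = .lam u ∧ Nf .long u := by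
  cases h with
  | lam h => exact ⟨_, rfl, h⟩

theorem Nf.of_long_app {Γ : Ctx B} {α β : Ty B} {t : Tm S Γ (.arr α β)} {u : Tm S Γ α}
    (h : Nf .long (.app t u)) : (∃ b, β = .base b) ∧ Nf .neutral (.app t u) := by
  cases h with
  | base h => exact ⟨⟨_, rfl⟩, h⟩

theorem Nf.ren {k : NfKind} {Γ Δ : Ctx B} {τ : Ty B} {t : Tm S Γ τ} (h : Nf k t)
    (ρ : Ren Γ Δ) : Nf k (t.ren ρ) := by
  induction h generalizing Δ with
  | lam _ ih => exact .lam (ih _)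
  | base _ ih => exact .base (ih _)
  | bvar x => exact .bvar _
  | mvar X => exact .mvar _
  | const c => exact .const _
  | app _ _ ih ih' => exact .app (ih _) (ih' _)

/-- A renaming creates neither redexes nor eta-expansions. -/
theorem Nf.of_ren {Γ Δ : Ctx B} {τ : Ty B} (t : Tm S Γ τ) (ρ : Ren Γ Δ) :
    (Nf .long (t.ren ρ) → Nf .long t) ∧ (Nf .neutral (t.ren ρ) → Nf .neutral t) := by
  induction t generalizing Δ with
  | lam t ih => exact ⟨fun h => .lam ((ih _).1 h.of_lam), fun h => nomatch h⟩
  | @app Γ α β t u iht ihu =>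
    have key : Nf .neutral ((Tm.app t u).ren ρ) → Nf .neutral (Tm.app t u) := fun h =>
      .app ((iht ρ).2 (Nf.of_app h).1) ((ihu ρ).1 (Nf.of_app h).2)
    refine ⟨fun h => ?_, key⟩
    obtain ⟨⟨b, rfl⟩, h'⟩ := Nf.of_long_app h
    exact .base (key h')
  | @bvar Γ τ x =>
    refine ⟨fun h => ?_, fun _ => .bvar x⟩
    cases τ with
    | base b => exact .base (.bvar x)
    | arr α β => nomatch h
  | @mvar Γ τ x =>
    refine ⟨fun h => ?_, fun _ => .mvar x⟩
    cases τ with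
    | base b => exact .base (.mvar x)
    | arr α β => nomatch h
  | @const Γ τ x =>
    refine ⟨fun h => ?_, fun _ => .const x⟩
    cases τ with
    | base b => exact .base (.const x)
    | arr α β => nomatch h

theorem Nf.eta {Γ : Ctx B} {τ : Ty B} {t : Tm S Γ τ} (h : Nf .neutral t) :
    Nf .long (HOAU.eta τ t) := by
  induction τ generalizing Γ with
  | base b => exact .base h
  | arr α β ihα ihβ => exact .lam (ihβ (.app (h.ren _) (ihα (.bvar _))))

theorem FlexApp.nf {Γ : Ctx B} {τ : Ty B} {l : List (Σ α : Ty B, Var Γ α)} {t : Tm S Γ τ}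
    (h : FlexApp l t) : Nf .neutral t := by
  induction h with
  | mvar X => exact .mvar X
  | app x _ _ ih => exact .app ih (Nf.eta (.bvar x))

theorem Pat.nf {k : NfKind} {Γ : Ctx B} {τ : Ty B} {t : Tm S Γ τ} (h : Pat k t) : Nf k t := by
  induction h with
  | lam _ ih => exact .lam ih
  | flex h => exact .base h.nf
  | rigid _ ih => exact .base ih
  | bvar x => exact .bvar _
  | const c => exact .const _
  | app _ _ ih ih' => exact .app ih ih'

/-! ### Eta-long variables as arguments -/

variable (S) in
/-- Eta-expanding a term of type `τ` that is already eta-long can be undone by beta-reduction. -/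
def EtaRed (τ : Ty B) : Prop :=
  ∀ ⦃Γ : Ctx B⦄ (u : Tm S Γ τ), Nf .long u → Red (eta τ u) u

variable (S) in
/-- `EtaRed` for all argument types of `τ`. -/
def EtaRedArgs : Ty B → Prop
  | .base _ => True
  | .arr α β => EtaRed S α ∧ EtaRedArgs β

/-- Applying an eta-expanded term to an eta-long argument. -/
theorem red_eta_app {Γ : Ctx B} {α β : Ty B} (hα : EtaRed S α) (n : Tm S Γ (.arr α β))
    {u : Tm S Γ α} (hu : Nf .long u) : Red (.app (eta _ n) u) (eta β (.app n u)) := by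
  refine .head (.beta _ _) ?_
  have : (eta β (.app (n.wk α) (eta α (.bvar .zero)))).inst u = eta β (.app n (eta α u)) := by
    have h := n.wk_inst u
    unfold Tm.inst at h ⊢
    simp only [eta_bsub, Tm.bsub, BSub.single]
    rw [← h]
    simp only [h]
  rw [this]
  exact Red.eta (.app .refl (hα u hu))

/-- Replacing variables by their eta-long forms in an eta-long term is undone by
beta-reduction. In a neutral term the head may stay eta-expanded. -/
theorem red_bsub_eta_aux {k : NfKind} {Γ Δ : Ctx B} {τ : Ty B} {t : Tm S Γ τ} (ht : Nf k t)
    (s : BSub S Γ Δ) (ρ : Ren Γ Δ)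
    (hs : ∀ (α : Ty B) (x : Var Γ α),
      s x = .bvar (ρ x) ∨ EtaRedArgs S α ∧ s x = eta α (.bvar (ρ x))) :
    Red (t.bsub s) (t.ren ρ) ∨
      k = .neutral ∧ EtaRedArgs S τ ∧ Red (t.bsub s) (eta τ (t.ren ρ)) := by
  induction ht generalizing Δ with
  | @lam Γ α β t _ ih =>
    left
    rcases ih (s.lift α) (ρ.lift α) (fun β x => by
      cases x with
      | zero => exact .inl rfl
      | succ x =>
        refine (hs β x).imp (fun h => ?_) (fun h => ⟨h.1, ?_⟩)
        · simp only [BSub.lift, h]; rfl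
        · simp only [BSub.lift, h.2, Tm.wk, eta_ren]; rfl) with h | h
    · exact h.lam
    · cases h.1
  | base _ ih =>
    left
    rcases ih s ρ hs with h | h
    · exact h
    · exact h.2.2
  | bvar x =>
    rcases hs _ x with h | h
    · left; simp only [Tm.bsub, Tm.ren, h]; exact .refl
    · right; refine ⟨rfl, h.1, ?_⟩; simp only [Tm.bsub, Tm.ren, h.2]; exact .refl
  | mvar X => exact .inl .refl
  | const c => exact .inl .refl
  | app ht hu ih ih' =>
    have hu' := (ih' s ρ hs).resolve_right (fun h => by cases h.1)
    rcases ih s ρ hs with h | ⟨_, h, h'⟩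
    · exact .inl (h.app hu')
    · exact .inr ⟨rfl, h.2, (h'.app hu').trans (red_eta_app h.1 _ (hu.ren ρ))⟩

/-- At `α → β`, the redex `(λ x. u)(eta x)` created by eta-expansion is evaluated by
`red_bsub_eta_aux` for the type `α`. -/
theorem etaRed_and_args (τ : Ty B) : EtaRed S τ ∧ EtaRedArgs S τ := by
  induction τ with
  | base b => exact ⟨fun _ _ _ => .refl, trivial⟩
  | arr α β ihα ihβ =>
    refine ⟨fun Γ u hu => ?_, ihα.1, ihβ.2⟩
    obtain ⟨u', rfl, hu'⟩ := hu.exists_lam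
    refine Red.lam (Relation.ReflTransGen.trans (Red.eta (.head (.beta _ _) ?_)) (ihβ.1 u' hu'))
    have h := (red_bsub_eta_aux hu'
      (fun _ x => BSub.single (eta α (.bvar .zero)) ((Ren.lift (fun _ x => .succ x) α) x))
      (fun _ x => x) (fun γ x => by
        cases x with
        | zero => exact .inr ⟨ihα.2, rfl⟩
        | succ x => exact .inl rfl)).resolve_right (fun h => by cases h.1)
    rw [Tm.ren_id, ← Tm.bsub_ren] at h
    exact h

theorem Nf.red_eta {Γ : Ctx B} {τ : Ty B} {u : Tm S Γ τ} (hu : Nf .long u) :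
    Red (HOAU.eta τ u) u :=
  (etaRed_and_args τ).1 u hu

/-- The assignment `s` sends each variable to its image under `ρ`, possibly written in eta-long
form. -/
def EtaSub {Γ Δ : Ctx B} (s : BSub S Γ Δ) (ρ : Ren Γ Δ) : Prop :=
  ∀ (α : Ty B) (x : Var Γ α), s x = .bvar (ρ x) ∨ s x = eta α (.bvar (ρ x))

/-- The assignment of the eta-long forms of the variables `ρ x`. -/
def etaVars {Γ Δ : Ctx B} (ρ : Ren Γ Δ) : BSub S Γ Δ := fun _ x => eta _ (.bvar (ρ x))

theorem EtaSub.etaVars {Γ Δ : Ctx B} (ρ : Ren Γ Δ) : EtaSub (etaVars ρ : BSub S Γ Δ) ρ :=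
  fun _ _ => .inr rfl

theorem EtaSub.lift {Γ Δ : Ctx B} {s : BSub S Γ Δ} {ρ : Ren Γ Δ} (h : EtaSub s ρ) (β : Ty B) :
    EtaSub (s.lift β) (ρ.lift β) := by
  intro α x
  cases x with
  | zero => exact .inl rfl
  | succ x =>
    refine (h α x).imp (fun h => ?_) (fun h => ?_)
    · simp only [BSub.lift, h]; rfl
    · simp only [BSub.lift, h, Tm.wk, eta_ren]; rfl

theorem EtaSub.red {Γ Δ : Ctx B} {τ : Ty B} {t : Tm S Γ τ} (ht : Nf .long t) {s : BSub S Γ Δ}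
    {ρ : Ren Γ Δ} (hs : EtaSub s ρ) : Red (t.bsub s) (t.ren ρ) :=
  (red_bsub_eta_aux ht s ρ fun α x => (hs α x).imp id fun h =>
    ⟨(etaRed_and_args α).2, h⟩).resolve_right (fun h => by cases h.1)

theorem EtaSub.red_eta {Γ Δ : Ctx B} {s : BSub S Γ Δ} {ρ : Ren Γ Δ} (hs : EtaSub s ρ)
    {α : Ty B} (x : Var Γ α) : Red (HOAU.eta α (s x)) (HOAU.eta α (.bvar (ρ x))) := by
  rcases hs α x with h | h
  · rw [h]
  · rw [h]; exact Nf.red_eta (Nf.eta (.bvar _))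

/-- Beta-reduction of `(λ x₁ … xₙ. t)(x₁ρ, …, xₙρ)`. -/
theorem red_appVars_lams {Γ Δ : Ctx B} {τ : Ty B} (ρ : Ren Γ Δ) (t : Tm S Γ τ) :
    Red (appVars Γ ρ (lams t).wkNil) (t.bsub (etaVars ρ)) := by
  induction Γ generalizing τ with
  | nil =>
    have h : (etaVars ρ : BSub S [] Δ) = fun _ x => .bvar (Ren.ofNil x) := by
      funext α x
      cases x
    rw [h, Tm.bsub_bvar]
    exact .refl
  | cons α Γ ih =>
    refine Relation.ReflTransGen.trans (Red.app (ih (fun _ x => ρ (.succ x)) (.lam t)) .refl) ?_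
    refine .head (.beta _ _) ?_
    have h := Tm.bsub_lift_inst t _ (etaVars ρ) rfl
    rw [← h]
    exact .refl

theorem red_appVars_bsub_aux {Γ Δ Θ : Ctx B} {τ : Ty B} (ρ : Ren Γ Δ) {s : BSub S Δ Θ}
    {ρ' : Ren Δ Θ} (hs : EtaSub s ρ') {t : Tm S Δ (arrows Γ τ)} {t' : Tm S Θ (arrows Γ τ)}
    (h : Red (t.bsub s) t') :
    Red ((appVars Γ ρ t).bsub s) (appVars Γ (fun _ x => ρ' (ρ x)) t') := by
  induction Γ generalizing τ with
  | nil => exact h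
  | cons α Γ ih =>
    refine Red.app (ih _ h) ?_
    rw [eta_bsub]
    exact hs.red_eta _

/-- A term `p(x₁ρ, …, xₙρ)` under a further renaming of variables, the new variables being
written in eta-long form or not. -/
theorem red_appVars_bsub {Γ Δ Θ : Ctx B} {τ : Ty B} (ρ : Ren Γ Δ) {s : BSub S Δ Θ}
    {ρ' : Ren Δ Θ} (hs : EtaSub s ρ') (p : Tm S [] (arrows Γ τ)) :
    Red ((appVars Γ ρ p.wkNil).bsub s) (appVars Γ (fun _ x => ρ' (ρ x)) p.wkNil) :=
  red_appVars_bsub_aux ρ hs (by rw [Tm.bsub_wkNil])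

/-! ### Flattened forms of associative and commutative constants -/

section Flat

variable {Γ : Ctx B} {α : Ty B} {f : S.Const (.arr α (.arr α α))} {E : Set Ax}

theorem EqMod.bin {a a' b b' : Tm S Γ α} (ha : EqMod E a a') (hb : EqMod E b b') :
    EqMod E (.bin f a b) (.bin f a' b') :=
  .app (.app (.refl _) ha) hb

/-- The right-nested application of `f` to the list `a :: l`. -/
def rightComb (f : S.Const (.arr α (.arr α α))) : Tm S Γ α → List (Tm S Γ α) → Tm S Γ α
  | a, [] => a
  | a, b :: l => .bin f a (rightComb f b l)

theorem rightComb_append (hE : Ax.assoc ∈ E) (hf : Ax.assoc ∈ S.ax f) (a b : Tm S Γ α)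
    (l m : List (Tm S Γ α)) :
    EqMod E (rightComb f a (l ++ b :: m)) (.bin f (rightComb f a l) (rightComb f b m)) := by
  induction l generalizing a with
  | nil => exact .refl _
  | cons c l ih => exact (EqMod.bin (.refl a) (ih c)).trans (.assoc f hE hf _ _ _)

theorem Flat.ne_nil {l : List (Tm S Γ α)} {t : Tm S Γ α} (h : Flat f l t) : l ≠ [] := by
  induction h with
  | leaf t _ => simp
  | node _ _ ih _ => simp [ih]

theorem Flat.of_mem {l : List (Tm S Γ α)} {t a : Tm S Γ α} (h : Flat f l t) (ha : a ∈ l) :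
    Flat f [a] a := by
  induction h with
  | leaf t ht =>
    obtain rfl : a = t := by simpa using ha
    exact .leaf _ ht
  | node _ _ ih ih' => exact (List.mem_append.1 ha).elim ih ih'

theorem Flat.eqMod_rightComb (hE : Ax.assoc ∈ E) (hf : Ax.assoc ∈ S.ax f)
    {l : List (Tm S Γ α)} {t : Tm S Γ α} (h : Flat f l t) :
    ∀ a m, l = a :: m → EqMod E t (rightComb f a m) := by
  induction h with
  | leaf t _ =>
    intro a m h
    obtain ⟨rfl, rfl⟩ := List.cons.inj h
    exact .refl _
  | @node l l' t t' h h' ih ih' =>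
    intro a m e
    obtain ⟨b, l, rfl⟩ := List.exists_cons_of_ne_nil h.ne_nil
    obtain ⟨c, l', rfl⟩ := List.exists_cons_of_ne_nil h'.ne_nil
    obtain ⟨rfl, rfl⟩ := List.cons.inj e
    exact (EqMod.bin (ih _ _ rfl) (ih' _ _ rfl)).trans (rightComb_append hE hf _ _ _ _).symm

/-- All bracketings of a list agree modulo associativity. -/
theorem Flat.eqMod (hE : Ax.assoc ∈ E) (hf : Ax.assoc ∈ S.ax f) {l : List (Tm S Γ α)}
    {t t' : Tm S Γ α} (h : Flat f l t) (h' : Flat f l t') : EqMod E t t' := by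
  obtain ⟨b, l, rfl⟩ := List.exists_cons_of_ne_nil h.ne_nil
  exact (h.eqMod_rightComb hE hf _ _ rfl).trans (h'.eqMod_rightComb hE hf _ _ rfl).symm

theorem rightComb_perm (hE : Ax.assoc ∈ E) (hf : Ax.assoc ∈ S.ax f) (hE' : Ax.comm ∈ E)
    (hf' : Ax.comm ∈ S.ax f) {l l' : List (Tm S Γ α)} (h : l.Perm l') :
    ∀ a m a' m', l = a :: m → l' = a' :: m' →
      EqMod E (rightComb f a m) (rightComb f a' m') := by
  induction h with
  | nil => intro _ _ _ _ h; cases h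
  | @cons x l l' h ih =>
    intro a m a' m' e e'
    obtain ⟨rfl, rfl⟩ := List.cons.inj e
    obtain ⟨rfl, rfl⟩ := List.cons.inj e'
    match l, l', h, ih with
    | [], [], _, _ => exact .refl _
    | [], _ :: _, h, _ => exact absurd h.length_eq (by simp)
    | _ :: _, [], h, _ => exact absurd h.length_eq (by simp)
    | b :: l, b' :: l', _, ih => exact .bin (.refl _) (ih _ _ _ _ rfl rfl)
  | swap x y l =>
    intro a m a' m' e e'
    obtain ⟨rfl, rfl⟩ := List.cons.inj e
    obtain ⟨rfl, rfl⟩ := List.cons.inj e'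
    cases l with
    | nil => exact .comm f hE' hf' _ _
    | cons c l =>
      exact (EqMod.assoc f hE hf _ _ _).trans
        ((EqMod.bin (.comm f hE' hf' _ _) (.refl _)).trans (EqMod.assoc f hE hf _ _ _).symm)
  | @trans l₁ l₂ l₃ h₁ _ ih ih' =>
    intro a m a' m' e e'
    obtain ⟨b, l, rfl⟩ : ∃ b l, l₂ = b :: l := List.exists_cons_of_ne_nil fun h => by
      subst h e
      exact absurd h₁.length_eq (by simp)
    exact (ih _ _ _ _ e rfl).trans (ih' _ _ _ _ rfl e')

/-- All bracketings of all rearrangements of a list agree modulo associativity and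
commutativity. -/
theorem Flat.eqMod_perm (hE : Ax.assoc ∈ E) (hf : Ax.assoc ∈ S.ax f) (hE' : Ax.comm ∈ E)
    (hf' : Ax.comm ∈ S.ax f) {l l' : List (Tm S Γ α)} {t t' : Tm S Γ α} (h : Flat f l t)
    (h' : Flat f l' t') (hl : l.Perm l') : EqMod E t t' := by
  obtain ⟨a, m, rfl⟩ := List.exists_cons_of_ne_nil h.ne_nil
  obtain ⟨a', m', rfl⟩ := List.exists_cons_of_ne_nil h'.ne_nil
  exact ((h.eqMod_rightComb hE hf _ _ rfl).trans
    (rightComb_perm hE hf hE' hf' hl _ _ _ _ rfl rfl)).trans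
    (h'.eqMod_rightComb hE hf _ _ rfl).symm

theorem Nf.of_bin {a b : Tm S Γ α} (h : Nf .long (.bin f a b)) :
    (∃ c, α = .base c) ∧ Nf .long a ∧ Nf .long b := by
  obtain ⟨hα, h⟩ := h.of_long_app
  obtain ⟨h, hb⟩ := h.of_app
  exact ⟨hα, h.of_app.2, hb⟩

theorem Nf.bin (hα : ∃ c, α = .base c) {a b : Tm S Γ α} (ha : Nf .long a) (hb : Nf .long b) :
    Nf .long (.bin f a b) := by
  obtain ⟨c, rfl⟩ := hα
  exact .base (.app (.app (.const f) ha) hb)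

theorem Flat.nf_of_mem {l : List (Tm S Γ α)} {t : Tm S Γ α} (h : Flat f l t)
    (ht : Nf .long t) : ∀ a ∈ l, Nf .long a := by
  induction h with
  | leaf t _ => simpa using ht
  | node _ _ ih ih' =>
    intro a ha
    exact (List.mem_append.1 ha).elim (ih ht.of_bin.2.1 a) (ih' ht.of_bin.2.2 a)

theorem Flat.nf (hα : ∃ c, α = .base c) {l : List (Tm S Γ α)} {t : Tm S Γ α} (h : Flat f l t)
    (hl : ∀ a ∈ l, Nf .long a) : Nf .long t := by
  induction h with
  | leaf t _ => simpa using hl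
  | node _ _ ih ih' =>
    exact .bin hα (ih fun a ha => hl a (List.mem_append_left _ ha))
      (ih' fun a ha => hl a (List.mem_append_right _ ha))

theorem Flat.base {l : List (Tm S Γ α)} {t : Tm S Γ α} (h : Flat f l t) (ht : Nf .long t)
    (hl : 2 ≤ l.length) : ∃ c, α = .base c := by
  cases h with
  | leaf => simp at hl
  | node => exact ht.of_bin.1

/-- The problems of an equational decomposition have sides in eta-long normal form. -/
theorem BinDec.nf {𝒢 : Calculus} {t s t₁ s₁ t₂ s₂ : Tm S Γ α}
    (h : BinDec f 𝒢 t s t₁ s₁ t₂ s₂) (ht : Nf .long t) (hs : Nf .long s) :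
    (∃ c, α = .base c) ∧
      (Nf .long t₁ ∧ Nf .long s₁) ∧ (Nf .long t₂ ∧ Nf .long s₂) := by
  have two : ∀ {l m : List (Tm S Γ α)}, l ≠ [] → m ≠ [] → 2 ≤ (l ++ m).length := by
    intro l m hl hm
    have := List.length_pos_iff.2 hl
    have := List.length_pos_iff.2 hm
    simp only [List.length_append]
    omega
  cases h with
  | decAL _ h₁ h₂ _ htl hsl h₁' h₂' h₃' =>
    have hα := htl.base ht (two h₁ h₂)
    have mt := htl.nf_of_mem ht
    have ms := hsl.nf_of_mem hs
    exact ⟨hα, ⟨h₁'.nf hα fun a h => mt a (by simp [h]), ms _ (by simp)⟩,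
      h₂'.nf hα fun a h => mt a (by simp [h]), h₃'.nf hα fun a h => ms a (by simp [h])⟩
  | decAR _ h₁ h₂ _ htl hsl h₁' h₂' h₃' =>
    have hα := hsl.base hs (two h₁ h₂)
    have mt := htl.nf_of_mem ht
    have ms := hsl.nf_of_mem hs
    exact ⟨hα, ⟨mt _ (by simp), h₁'.nf hα fun a h => ms a (by simp [h])⟩,
      h₂'.nf hα fun a h => mt a (by simp [h]), h₃'.nf hα fun a h => ms a (by simp [h])⟩
  | decC _ =>
    exact ⟨ht.of_bin.1, ⟨ht.of_bin.2.1, hs.of_bin.2.1⟩, ht.of_bin.2.2, hs.of_bin.2.2⟩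
  | decCSwap _ =>
    exact ⟨ht.of_bin.1, ⟨ht.of_bin.2.1, hs.of_bin.2.2⟩, ht.of_bin.2.2, hs.of_bin.2.1⟩
  | decACL _ h₁ h₂ _ hp htl hsl h₁' h₂' h₃' =>
    have hα := htl.base ht (hp.length_eq ▸ two h₁ h₂)
    have mt := htl.nf_of_mem ht
    have ms := hsl.nf_of_mem hs
    exact ⟨hα, ⟨h₁'.nf hα fun a h => mt a (hp.mem_iff.2 (by simp [h])), ms _ (by simp)⟩,
      h₂'.nf hα fun a h => mt a (hp.mem_iff.2 (by simp [h])),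
      h₃'.nf hα fun a h => ms a (by
        rcases List.mem_append.1 h with h | h <;> simp [h])⟩
  | decACR _ h₁ h₂ _ hp htl hsl h₁' h₂' h₃' =>
    have hα := hsl.base hs (hp.length_eq ▸ two h₁ h₂)
    have mt := htl.nf_of_mem ht
    have ms := hsl.nf_of_mem hs
    exact ⟨hα, ⟨mt _ (by simp), h₁'.nf hα fun a h => ms a (hp.mem_iff.2 (by simp [h]))⟩,
      h₂'.nf hα fun a h => mt a (by
        rcases List.mem_append.1 h with h | h <;> simp [h]),
      h₃'.nf hα fun a h => ms a (hp.mem_iff.2 (by simp [h]))⟩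

/-- An equational decomposition splits both sides into two arguments of `f`, up to the axioms of
`f`. -/
theorem BinDec.eqMod {𝒢 : Calculus} (hE : 𝒢.theory ⊆ E) {t s t₁ s₁ t₂ s₂ : Tm S Γ α}
    (h : BinDec f 𝒢 t s t₁ s₁ t₂ s₂) :
    EqMod E (.bin f t₁ t₂) t ∧ EqMod E (.bin f s₁ s₂) s := by
  cases h with
  | decAL hf _ _ _ htl hsl h₁ h₂ h₃ =>
    have hA : Ax.assoc ∈ S.ax f := by rw [hf]; rfl
    have hA' : Ax.assoc ∈ E := hE rfl
    exact ⟨(h₁.node h₂).eqMod hA' hA htl,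
      ((hsl.of_mem (by simp)).node h₃).eqMod hA' hA hsl⟩
  | decAR hf _ _ _ htl hsl h₁ h₂ h₃ =>
    have hA : Ax.assoc ∈ S.ax f := by rw [hf]; rfl
    have hA' : Ax.assoc ∈ E := hE rfl
    exact ⟨((htl.of_mem (by simp)).node h₂).eqMod hA' hA htl,
      (h₁.node h₃).eqMod hA' hA hsl⟩
  | decC _ => exact ⟨.refl _, .refl _⟩
  | decCSwap hf => exact ⟨.refl _, .comm f (hE rfl) (by rw [hf]; rfl) _ _⟩
  | decACL hf _ _ _ hp htl hsl h₁ h₂ h₃ =>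
    have hA : Ax.assoc ∈ S.ax f := by simp [hf]
    have hA' : Ax.assoc ∈ E := hE (.inl rfl)
    have hC : Ax.comm ∈ S.ax f := by simp [hf]
    have hC' : Ax.comm ∈ E := hE (.inr rfl)
    exact ⟨(h₁.node h₂).eqMod_perm hA' hA hC' hC htl hp.symm,
      ((hsl.of_mem (by simp)).node h₃).eqMod_perm hA' hA hC' hC hsl (by simpa using List.perm_middle.symm)⟩
  | decACR hf _ _ _ hp htl hsl h₁ h₂ h₃ =>
    have hA : Ax.assoc ∈ S.ax f := by simp [hf]
    have hA' : Ax.assoc ∈ E := hE (.inl rfl)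
    have hC : Ax.comm ∈ S.ax f := by simp [hf]
    have hC' : Ax.comm ∈ E := hE (.inr rfl)
    exact ⟨((htl.of_mem (by simp)).node h₂).eqMod_perm hA' hA hC' hC htl
      (by simpa using List.perm_middle.symm), (h₁.node h₃).eqMod_perm hA' hA hC' hC hsl hp.symm⟩

end Flat

/-! ### Instances and patterns as predicates on values of generalization variables -/

/-- `p(x₁, …, xₙ)` equals `t` modulo `E`, for a closed term `p` and the variables `x₁, …, xₙ` of
the context of `t`. The renaming `ρ` makes the notion stable under changes of the context. -/
def IsValue (E : Set Ax) {Γ : Ctx B} {τ : Ty B} (t : Tm S Γ τ) (p : Tm S [] (arrows Γ τ)) :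
    Prop :=
  ∀ ⦃Δ : Ctx B⦄ (ρ : Ren Γ Δ), EqMod E (appVars Γ ρ p.wkNil) (t.ren ρ)

/-- The renaming identifies no two variables. -/
def Ren.Inj {Γ Δ : Ctx B} (ρ : Ren Γ Δ) : Prop :=
  ∀ α : Ty B, Function.Injective (ρ (α := α))

/-- `p(y₁, …, yₙ)` beta-reduces to an eta-long pattern for all pairwise distinct variables
`y₁, …, yₙ` of the types in `Γ`. Unlike being an eta-long pattern, this holds of a bare capital
variable whose type has as many arguments as `Γ`. -/
def IsPatternFun (Γ : Ctx B) (τ : Ty B) (p : Tm S [] (arrows Γ τ)) : Prop :=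
  ∀ ⦃Δ : Ctx B⦄ (ρ : Ren Γ Δ), ρ.Inj →
    ∃ r : Tm S Δ τ, Red (appVars Γ ρ p.wkNil) r ∧ Pat .long r

theorem Ren.Inj.comp {Γ Δ Θ : Ctx B} {ρ : Ren Γ Δ} {ρ' : Ren Δ Θ} (h' : ρ'.Inj) (h : ρ.Inj) :
    Ren.Inj (fun _ x => ρ' (ρ x) : Ren Γ Θ) :=
  fun α _ _ e => h α (h' α e)

theorem Ren.Inj.lift {Γ Δ : Ctx B} {ρ : Ren Γ Δ} (h : ρ.Inj) (β : Ty B) : (ρ.lift β).Inj := by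
  intro α x y e
  cases x with
  | zero =>
    cases y with
    | zero => rfl
    | succ y => cases e
  | succ x =>
    cases y with
    | zero => cases e
    | succ y =>
      simp only [Ren.lift, Var.succ.injEq] at e
      rw [h α e]

theorem Sub.ren_inj {Γ Δ : Ctx B} (e : Sub Δ Γ) : e.ren.Inj := by
  induction e with
  | nil => exact fun _ _ _ h => h
  | skip e ih =>
    intro α x y h
    simp only [Sub.ren, Var.succ.injEq] at h
    exact ih α h
  | keep e ih => exact ih.lift _

theorem IsValue.of_lams {E : Set Ax} {Γ : Ctx B} {τ : Ty B} {t g : Tm S Γ τ}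
    (h : ∀ ⦃Δ : Ctx B⦄ (ρ : Ren Γ Δ), EqMod E (g.bsub (etaVars ρ)) (t.ren ρ)) :
    IsValue E t (lams g) :=
  fun _ ρ => (EqMod.of_red (red_appVars_lams ρ g)).trans (h ρ)

theorem IsPatternFun.of_lams {Γ : Ctx B} {τ : Ty B} {g : Tm S Γ τ}
    (h : ∀ ⦃Δ : Ctx B⦄ (ρ : Ren Γ Δ), ρ.Inj →
      ∃ r : Tm S Δ τ, Red (g.bsub (etaVars ρ)) r ∧ Pat .long r) :
    IsPatternFun Γ τ (lams g) := by
  intro Δ ρ hρ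
  obtain ⟨r, hr, hp⟩ := h ρ hρ
  exact ⟨r, (red_appVars_lams ρ g).trans hr, hp⟩

theorem IsValue.lams {E : Set Ax} {Γ : Ctx B} {τ : Ty B} {t : Tm S Γ τ} (ht : Nf .long t) :
    IsValue E t (HOAU.lams t) :=
  .of_lams fun _ ρ => .of_red ((EtaSub.etaVars ρ).red ht)

/-- `Y(x₁ρ, …, xₙρ)` for an injective `ρ` is a capital variable applied to distinct variables, all
in the range of `ρ`. -/
theorem flexApp_appVars {Γ Δ : Ctx B} {τ : Ty B} (ρ : Ren Γ Δ) (hρ : ρ.Inj) (Y : ℕ) :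
    ∃ l, FlexApp l (appVars Γ ρ (.mvar Y : Tm S Δ (arrows Γ τ))) ∧
      ∀ (α : Ty B) (y : Var Δ α), ⟨α, y⟩ ∈ l → ∃ x, y = ρ x := by
  induction Γ generalizing τ with
  | nil => exact ⟨[], .mvar Y, by simp⟩
  | cons α Γ ih =>
    obtain ⟨l, hl, hm⟩ := ih (τ := .arr α τ) (fun _ x => ρ (.succ x))
      fun β x y h => by simpa using hρ β h
    refine ⟨⟨α, ρ .zero⟩ :: l, .app _ hl fun h => ?_, fun β y hy => ?_⟩
    · obtain ⟨x, hx⟩ := hm _ _ h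
      cases hρ α hx
    · rcases List.mem_cons.1 hy with h | h
      · cases h
        exact ⟨_, rfl⟩
      · obtain ⟨x, rfl⟩ := hm _ _ h
        exact ⟨_, rfl⟩

/-- A bare capital variable is eta-short, but becomes an eta-long pattern once applied to all its
arguments. -/
theorem isPatternFun_mvar (Γ : Ctx B) (b : B) (Y : ℕ) :
    IsPatternFun Γ (.base b) (.mvar Y : Tm S [] (arrows Γ (.base b))) := by
  intro Δ ρ hρ
  obtain ⟨l, hl, -⟩ := flexApp_appVars (S := S) (τ := .base b) ρ hρ Y
  exact ⟨_, .refl, .flex hl⟩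

/-- The value of `Y(x₁ρ, …, xₙρ)` under a substitution for capital variables and a change of the
lower-case variables. -/
theorem red_msub_appVars {Γ Δ Θ : Ctx B} {τ : Ty B} (ρ : Ren Γ Δ) {s : BSub S Δ Θ}
    {ρ' : Ren Δ Θ} (hs : EtaSub s ρ') (θ : Subst S) (Y : ℕ) :
    Red (((appVars Γ ρ (.mvar Y) : Tm S Δ τ).msub θ).bsub s)
      (appVars Γ (fun _ x => ρ' (ρ x)) (θ ⟨arrows Γ τ, Y⟩).wkNil) := by
  rw [appVars_msub]
  exact red_appVars_bsub ρ hs _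

theorem IsValue.genTerm {E : Set Ax} {Γ Θ : Ctx B} {τ : Ty B} {t : Tm S Γ τ} {θ : Subst S}
    {Y : ℕ} (h : IsValue E t (θ ⟨arrows Γ τ, Y⟩)) {s : BSub S Γ Θ} {ρ : Ren Γ Θ}
    (hs : EtaSub s ρ) :
    EqMod E (((HOAU.genTerm Y : Tm S Γ τ).msub θ).bsub s) (t.ren ρ) :=
  (EqMod.of_red (red_msub_appVars (fun _ x => x) hs θ Y)).trans (h ρ)

theorem IsPatternFun.genTerm {Γ Θ : Ctx B} {τ : Ty B} {θ : Subst S}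
    {Y : ℕ} (h : IsPatternFun Γ τ (θ ⟨arrows Γ τ, Y⟩)) {s : BSub S Γ Θ} {ρ : Ren Γ Θ}
    (hs : EtaSub s ρ) (hρ : ρ.Inj) :
    ∃ r, Red (((HOAU.genTerm Y : Tm S Γ τ).msub θ).bsub s) r ∧ Pat .long r := by
  obtain ⟨r, hr, hp⟩ := h ρ hρ
  exact ⟨r, (red_msub_appVars (fun _ x => x) hs θ Y).trans hr, hp⟩

/-! ### Decomposition of rigid heads -/

theorem DecArgs.base {Γ : Ctx B} {τ : Ty B} {t s g : Tm S Γ τ} {L : List (AUP S)}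
    (h : DecArgs t s g L) (ht : Nf .long t) : ∃ b, τ = .base b := by
  cases τ with
  | base b => exact ⟨b, rfl⟩
  | arr α β =>
    obtain ⟨u, rfl, -⟩ := ht.exists_lam
    cases h

theorem DecArgs.nf {Γ : Ctx B} {τ : Ty B} {t s g : Tm S Γ τ} {L : List (AUP S)}
    (h : DecArgs t s g L) (ht : Nf .neutral t) (hs : Nf .neutral s) :
    ∀ P ∈ L, Nf .long P.lhs ∧ Nf .long P.rhs := by
  induction h with
  | bvar x => simp
  | const c hc => simp
  | app t' s' Y _ ih =>
    intro P hP
    rcases List.mem_cons.1 hP with rfl | hP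
    · exact ⟨ht.of_app.2, hs.of_app.2⟩
    · exact ih ht.of_app.1 hs.of_app.1 P hP

theorem DecArgs.eqMod_lhs {E : Set Ax} {Γ Θ : Ctx B} {τ : Ty B} {t s g : Tm S Γ τ}
    {L : List (AUP S)} (h : DecArgs t s g L) {θ : Subst S}
    (hL : ∀ P ∈ L, IsValue E P.lhs (θ P.var)) {σ : BSub S Γ Θ} {ρ : Ren Γ Θ}
    (hσ : EtaSub σ ρ) : EqMod E ((g.msub θ).bsub σ) (t.ren ρ) := by
  induction h with
  | bvar x =>
    rcases hσ _ x with h | h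
    · simp only [Tm.msub, Tm.bsub, h]; exact .refl _
    · simp only [Tm.msub, Tm.bsub, h]; exact .eta_long _
  | const c hc => exact .refl _
  | app t' s' Y _ ih =>
    exact .app (ih fun P hP => hL P (List.mem_cons_of_mem _ hP))
      (IsValue.genTerm (hL _ List.mem_cons_self) hσ)

theorem DecArgs.eqMod_rhs {E : Set Ax} {Γ Θ : Ctx B} {τ : Ty B} {t s g : Tm S Γ τ}
    {L : List (AUP S)} (h : DecArgs t s g L) {θ : Subst S}
    (hL : ∀ P ∈ L, IsValue E P.rhs (θ P.var)) {σ : BSub S Γ Θ} {ρ : Ren Γ Θ}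
    (hσ : EtaSub σ ρ) : EqMod E ((g.msub θ).bsub σ) (s.ren ρ) := by
  induction h with
  | bvar x =>
    rcases hσ _ x with h | h
    · simp only [Tm.msub, Tm.bsub, h]; exact .refl _
    · simp only [Tm.msub, Tm.bsub, h]; exact .eta_long _
  | const c hc => exact .refl _
  | app t' s' Y _ ih =>
    exact .app (ih fun P hP => hL P (List.mem_cons_of_mem _ hP))
      (IsValue.genTerm (hL _ List.mem_cons_self) hσ)

/-- The term `h(Y₁(x₁, …, xₙ), …, Yₘ(x₁, …, xₙ))` becomes a rigid pattern, whose head may still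
be eta-expanded when it is a variable. -/
theorem DecArgs.pat {Γ Θ : Ctx B} {τ : Ty B} {t s g : Tm S Γ τ}
    {L : List (AUP S)} (h : DecArgs t s g L) {θ : Subst S}
    (hL : ∀ P ∈ L, IsPatternFun P.ctx P.ty (θ P.var)) {σ : BSub S Γ Θ} {ρ : Ren Γ Θ}
    (hσ : EtaSub σ ρ) (hρ : ρ.Inj) :
    ∃ n : Tm S Θ τ, Pat .neutral n ∧
      (Red ((g.msub θ).bsub σ) n ∨ Red ((g.msub θ).bsub σ) (eta τ n)) := by
  induction h with
  | bvar x =>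
    refine ⟨.bvar (ρ x), .bvar _, ?_⟩
    rcases hσ _ x with h | h
    · left; simp only [Tm.msub, Tm.bsub, h]; exact .refl
    · right; simp only [Tm.msub, Tm.bsub, h]; exact .refl
  | const c hc => exact ⟨.const c, .const c, .inl .refl⟩
  | @app α β t s g L t' s' Y _ ih =>
    obtain ⟨n, hn, hr⟩ := ih fun P hP => hL P (List.mem_cons_of_mem _ hP)
    obtain ⟨r, hr', hp⟩ := IsPatternFun.genTerm (hL _ List.mem_cons_self) hσ hρ
    refine ⟨.app n r, .app hn hp, hr.imp (fun h => h.app hr') fun h => ?_⟩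
    exact (h.app hr').trans (red_eta_app (etaRed_and_args α).1 n hp.nf)

/-! ### The invariant -/

/-- The problems of a state. -/
def State.problems (st : State S) : Set (AUP S) := st.active ∪ st.store

/-- The effect of `σ{X ↦ p}` on a property `Q` of the values of generalization variables: if `p`
gives the variable of the solved problem `P` a value with the property `Q` whenever the remaining
problems have such values, then the property of the initial problem `P₀` is kept. -/
theorem extend_spec (Q : (P : AUP S) → Tm S [] P.var.ty → Prop) {P₀ P : AUP S}
    {T T' : Set (AUP S)} {σ : Subst S} (p : Tm S [] P.var.ty)
    (hP : P ∈ T) (inj : Set.InjOn AUP.var T) (hsub : ∀ P' ∈ T, P' ≠ P → P' ∈ T')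
    (hp : ∀ θ : Subst S, (∀ P' ∈ T', Q P' (θ P'.var)) → Q P (p.msub θ))
    (h : ∀ θ : Subst S, (∀ P' ∈ T, Q P' (θ P'.var)) → Q P₀ ((σ P₀.var).msub θ))
    (θ : Subst S) (hθ : ∀ P' ∈ T', Q P' (θ P'.var)) :
    Q P₀ ((σ.extend P.name p P₀.var).msub θ) := by
  classical
  have e : (σ.extend P.name p P₀.var).msub θ =
      (σ P₀.var).msub fun w => (Function.update Subst.id P.var p w).msub θ := by
    unfold Subst.extend
    rw [Tm.msub_msub]
    congr!
  rw [e]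
  refine h _ fun P' hP' => ?_
  by_cases hPP : P' = P
  · subst hPP
    rw [Function.update_self]
    exact hp θ hθ
  · rw [Function.update_of_ne fun hv => hPP (inj hP' hP hv)]
    have : (Subst.id P'.var : Tm S [] P'.var.ty).msub θ = θ P'.var := Tm.ren_nil _ _
    rw [this]
    exact hθ P' (hsub P' hP' hPP)

/-- Any values that solve the problems of the state make the substitution of the state send the
initial variable to a value for the initial problem `P₀`; and any values that are patterns make
it a pattern. The remaining fields keep the variables of distinct problems distinct, so that the
values can be chosen independently, and provide the normal forms and base types that the rules
and the final state need. -/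
structure Invariant (E : Set Ax) (P₀ : AUP S) (st : State S) : Prop where
  inj : Set.InjOn AUP.var st.problems
  nf : ∀ P ∈ st.problems, Nf .long P.lhs ∧ Nf .long P.rhs
  finite : st.store.Finite
  base : ∀ P ∈ st.store, ∃ b, P.ty = .base b
  lhs : ∀ θ : Subst S, (∀ P ∈ st.problems, IsValue E P.lhs (θ P.var)) →
    IsValue E P₀.lhs ((st.sub P₀.var).msub θ)
  rhs : ∀ θ : Subst S, (∀ P ∈ st.problems, IsValue E P.rhs (θ P.var)) →
    IsValue E P₀.rhs ((st.sub P₀.var).msub θ)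
  pat : ∀ θ : Subst S, (∀ P ∈ st.problems, IsPatternFun P.ctx P.ty (θ P.var)) →
    IsPatternFun P₀.ctx P₀.ty ((st.sub P₀.var).msub θ)

/-- The invariant passes to a state that arises by solving the problem `P` with the term `p` and
adding the problems `N`, whose variables are new. -/
theorem Invariant.step {E : Set Ax} {P₀ : AUP S} {st st' : State S} (h : Invariant E P₀ st)
    {P : AUP S} (p : Tm S [] P.var.ty) (N : Set (AUP S))
    (hP : P ∈ st.problems) (hσ : st'.sub = st.sub.extend P.name p)
    (hsub : ∀ P' ∈ st.problems, P' ≠ P → P' ∈ st'.problems)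
    (hnew : ∀ P' ∈ st'.problems, P' ∈ st.problems ∨ P' ∈ N)
    (hN : ∀ P' ∈ N, st.Fresh P'.var) (hNinj : Set.InjOn AUP.var N)
    (hNnf : ∀ P' ∈ N, Nf .long P'.lhs ∧ Nf .long P'.rhs)
    (finite : st'.store.Finite) (base : ∀ P' ∈ st'.store, ∃ b, P'.ty = .base b)
    (lhs : ∀ θ : Subst S, (∀ P' ∈ st'.problems, IsValue E P'.lhs (θ P'.var)) →
      IsValue E P.lhs (p.msub θ))
    (rhs : ∀ θ : Subst S, (∀ P' ∈ st'.problems, IsValue E P'.rhs (θ P'.var)) →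
      IsValue E P.rhs (p.msub θ))
    (pat : ∀ θ : Subst S, (∀ P' ∈ st'.problems, IsPatternFun P'.ctx P'.ty (θ P'.var)) →
      IsPatternFun P.ctx P.ty (p.msub θ)) :
    Invariant E P₀ st' where
  inj := by
    intro P₁ h₁ P₂ h₂ e
    rcases hnew _ h₁ with h₁ | h₁ <;> rcases hnew _ h₂ with h₂ | h₂
    · exact h.inj h₁ h₂ e
    · exact absurd e ((hN _ h₂).1 _ h₁).1
    · exact absurd e.symm ((hN _ h₁).1 _ h₂).1
    · exact hNinj h₁ h₂ e
  nf P' h' := (hnew P' h').elim (h.nf P') (hNnf P')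
  finite := finite
  base := base
  lhs := by
    rw [hσ]
    exact extend_spec (fun P p => IsValue E P.lhs p) p hP h.inj hsub lhs h.lhs
  rhs := by
    rw [hσ]
    exact extend_spec (fun P p => IsValue E P.rhs p) p hP h.inj hsub rhs h.rhs
  pat := by
    rw [hσ]
    exact extend_spec (fun P p => IsPatternFun P.ctx P.ty p) p hP h.inj hsub pat h.pat

theorem IsValue.lams_bin {E : Set Ax} {Γ : Ctx B} {α : Ty B}
    {f : S.Const (.arr α (.arr α α))} {t t₁ t₂ : Tm S Γ α} (h : EqMod E (.bin f t₁ t₂) t)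
    {θ : Subst S} {Y₁ Y₂ : ℕ} (h₁ : IsValue E t₁ (θ ⟨arrows Γ α, Y₁⟩))
    (h₂ : IsValue E t₂ (θ ⟨arrows Γ α, Y₂⟩)) :
    IsValue E t ((HOAU.lams (.bin f (HOAU.genTerm Y₁) (HOAU.genTerm Y₂) : Tm S Γ α)).msub θ) := by
  rw [lams_msub]
  refine .of_lams fun Δ ρ => ?_
  exact (EqMod.bin (h₁.genTerm (.etaVars ρ)) (h₂.genTerm (.etaVars ρ))).trans (h.ren ρ)

theorem IsValue.lams_appVars {E : Set Ax} {Γ Δ : Ctx B} {τ : Ty B} {t : Tm S Γ τ}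
    {t' : Tm S Δ τ} (e : Ren Δ Γ) (h : EqMod E (t'.ren e) t) {θ : Subst S} {Y : ℕ}
    (hY : IsValue E t' (θ ⟨arrows Δ τ, Y⟩)) :
    IsValue E t ((HOAU.lams (appVars Δ e (.mvar Y) : Tm S Γ τ)).msub θ) := by
  rw [lams_msub]
  refine .of_lams fun Θ ρ => ?_
  have h' := (hY fun _ x => ρ (e x)).trans (by rw [← Tm.ren_ren]; exact h.ren ρ)
  exact (EqMod.of_red (red_msub_appVars e (.etaVars ρ) θ Y)).trans h'

theorem IsPatternFun.lams_appVars {Γ Δ : Ctx B} {τ : Ty B} (e : Ren Δ Γ) (he : e.Inj)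
    {θ : Subst S} {Y : ℕ} (hY : IsPatternFun Δ τ (θ ⟨arrows Δ τ, Y⟩)) :
    IsPatternFun Γ τ ((lams (appVars Δ e (.mvar Y) : Tm S Γ τ)).msub θ) := by
  rw [lams_msub]
  refine .of_lams fun Θ ρ hρ => ?_
  obtain ⟨r, hr, hp⟩ := hY (fun _ x => ρ (e x)) (hρ.comp he)
  exact ⟨r, (red_msub_appVars e (.etaVars ρ) θ Y).trans hr, hp⟩

/-- The type of an active problem that is decomposed is a base type, because its sides are
eta-long; so the term `p` that replaces its variable evaluates to a rigid term without an
eta-expanded head. -/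
theorem Step.invariant {𝒢 : Calculus} {E : Set Ax} (hE : 𝒢.theory ⊆ E) {P₀ : AUP S}
    {st st' : State S} (hst : Step 𝒢 E st st') (h : Invariant E P₀ st) :
    Invariant E P₀ st' := by
  cases hst with
  | @dec A R σ Γ τ X t s g L hA hdec hnd hfresh =>
    have hP := h.nf (aup X t s) (.inl (.inl rfl))
    obtain ⟨b, rfl⟩ := hdec.base hP.1
    refine h.step (P := aup X t s) (lams g) {P | P ∈ L} (.inl (.inl rfl)) rfl
      ?_ ?_ hfresh (fun P hP Q hQ e => List.inj_on_of_nodup_map hnd hP hQ e)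
      (hdec.nf hP.1.of_base hP.2.of_base) h.finite h.base ?_ ?_ ?_
    · rintro P ((hP | hP) | hP) hne
      · exact absurd hP hne
      · exact .inl (.inr hP)
      · exact .inr hP
    · rintro P ((hP | hP) | hP)
      · exact .inr hP
      · exact .inl (.inl (.inr hP))
      · exact .inl (.inr hP)
    · intro θ hθ
      rw [lams_msub]
      exact .of_lams fun Δ ρ =>
        hdec.eqMod_lhs (fun P hP => hθ P (.inl (.inl hP))) (.etaVars ρ)
    · intro θ hθ
      rw [lams_msub]
      exact .of_lams fun Δ ρ =>
        hdec.eqMod_rhs (fun P hP => hθ P (.inl (.inl hP))) (.etaVars ρ)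
    · intro θ hθ
      rw [lams_msub]
      refine .of_lams fun Δ ρ hρ => ?_
      obtain ⟨n, hn, hr⟩ :=
        hdec.pat (fun P hP => hθ P (.inl (.inl hP))) (.etaVars ρ) hρ
      exact ⟨n, hr.elim id id, .rigid hn⟩
  | @abs A R σ Γ α β X X' t s hA hfresh =>
    have hP := h.nf (aup X (.lam t) (.lam s)) (.inl (.inl rfl))
    refine h.step (P := aup X (.lam t) (.lam s)) (lams (.lam (genTerm X' : Tm S (α :: Γ) β)))
      {aup X' t s} (.inl (.inl rfl)) rfl ?_ ?_ ?_ ?_ ?_ h.finite h.base ?_ ?_ ?_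
    · rintro P ((hP | hP) | hP) hne
      · exact absurd hP hne
      · exact .inl (.inr hP)
      · exact .inr hP
    · rintro P ((hP | hP) | hP)
      · exact .inr hP
      · exact .inl (.inl (.inr hP))
      · exact .inl (.inr hP)
    · rintro P rfl
      exact hfresh
    · exact Set.injOn_singleton _ _
    · rintro P rfl
      exact ⟨hP.1.of_lam, hP.2.of_lam⟩
    · intro θ hθ
      rw [lams_msub]
      exact .of_lams fun Δ ρ => .lam
        (IsValue.genTerm (hθ (aup X' t s) (.inl (.inl rfl))) ((EtaSub.etaVars ρ).lift α))
    · intro θ hθ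
      rw [lams_msub]
      exact .of_lams fun Δ ρ => .lam
        (IsValue.genTerm (hθ (aup X' t s) (.inl (.inl rfl))) ((EtaSub.etaVars ρ).lift α))
    · intro θ hθ
      rw [lams_msub]
      refine .of_lams fun Δ ρ hρ => ?_
      obtain ⟨r, hr, hp⟩ := IsPatternFun.genTerm (hθ (aup X' t s) (.inl (.inl rfl)))
        ((EtaSub.etaVars ρ).lift α) (hρ.lift α)
      exact ⟨.lam r, hr.lam, .lam hp⟩
  | @sol A R σ Γ Δ b X Y t s t' s' e k k' hA _ _ _ ht hs _ hfresh =>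
    have hP := h.nf (aup X t s) (.inl (.inl rfl))
    refine h.step (P := aup X t s) (lams (appVars Δ e.ren (.mvar Y) : Tm S Γ (.base b)))
      {aup Y t' s'} (.inl (.inl rfl)) rfl ?_ ?_ ?_ ?_ ?_ (h.finite.insert _) ?_ ?_ ?_ ?_
    · rintro P ((hP | hP) | hP) hne
      · exact absurd hP hne
      · exact .inl hP
      · exact .inr (.inr hP)
    · rintro P (hP | (hP | hP))
      · exact .inl (.inl (.inr hP))
      · exact .inr hP
      · exact .inl (.inr hP)
    · rintro P rfl
      exact hfresh
    · exact Set.injOn_singleton _ _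
    · rintro P rfl
      have h₁ : Nf .long t := hP.1
      have h₂ : Nf .long s := hP.2
      rw [ht] at h₁
      rw [hs] at h₂
      exact ⟨(Nf.of_ren _ _).1 h₁, (Nf.of_ren _ _).1 h₂⟩
    · rintro P (rfl | hP)
      · exact ⟨b, rfl⟩
      · exact h.base P hP
    · intro θ hθ
      exact .lams_appVars e.ren (by rw [ht]; exact .refl _) (hθ (aup Y t' s') (.inr (.inl rfl)))
    · intro θ hθ
      exact .lams_appVars e.ren (by rw [hs]; exact .refl _) (hθ (aup Y t' s') (.inr (.inl rfl)))
    · intro θ hθ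
      exact .lams_appVars e.ren e.ren_inj (hθ (aup Y t' s') (.inr (.inl rfl)))
  | @mer A R σ Γ Δ τ X Y t₁ t₂ s₁ s₂ π hne hX hY hπ h₁ h₂ =>
    refine h.step (P := aup Y s₁ s₂) (lams (appVars Γ π (.mvar X) : Tm S Δ τ)) ∅
      (.inr (.inr (.inl rfl))) rfl ?_ ?_ (fun _ h => h.elim) (Set.injOn_empty _)
      (fun _ h => h.elim) (h.finite.subset ?_) ?_ ?_ ?_ ?_
    · rintro P (hP | (hP | hP | hP)) hne
      · exact .inl hP
      · exact .inr (.inl hP)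
      · exact absurd hP hne
      · exact .inr (.inr hP)
    · rintro P (hP | hP | hP)
      · exact .inl (.inl hP)
      · exact .inl (.inr (.inl hP))
      · exact .inl (.inr (.inr (.inr hP)))
    · exact Set.insert_subset_insert (Set.subset_insert _ _)
    · rintro P (hP | hP)
      · exact h.base P (.inl hP)
      · exact h.base P (.inr (.inr hP))
    · intro θ hθ
      exact .lams_appVars π h₁ (hθ (aup X t₁ t₂) (.inr (.inl rfl)))
    · intro θ hθ
      exact .lams_appVars π h₂ (hθ (aup X t₁ t₂) (.inr (.inl rfl)))
    · intro θ hθ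
      exact .lams_appVars π (fun α => (hπ α).1) (hθ (aup X t₁ t₂) (.inr (.inl rfl)))
  | @eqDec A R σ Γ α X Y₁ Y₂ t s t₁ s₁ t₂ s₂ f hA hdec hne hf₁ hf₂ =>
    have hP := h.nf (aup X t s) (.inl (.inl rfl))
    obtain ⟨⟨b, rfl⟩, hn₁, hn₂⟩ := hdec.nf hP.1 hP.2
    refine h.step (P := aup X t s) (lams (.bin f (genTerm Y₁) (genTerm Y₂)))
      {aup Y₁ t₁ s₁, aup Y₂ t₂ s₂} (.inl (.inl rfl)) rfl ?_ ?_ ?_ ?_ ?_ h.finite h.base ?_ ?_ ?_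
    · rintro P ((hP | hP) | hP) hne
      · exact absurd hP hne
      · exact .inl (.inr hP)
      · exact .inr hP
    · rintro P ((hP | hP) | hP)
      · exact .inr hP
      · exact .inl (.inl (.inr hP))
      · exact .inl (.inr hP)
    · rintro P (rfl | rfl)
      · exact hf₁
      · exact hf₂
    · exact (Set.injOn_pair).2 fun h => absurd h hne
    · rintro P (rfl | rfl)
      · exact hn₁
      · exact hn₂
    · intro θ hθ
      exact .lams_bin (hdec.eqMod hE).1 (hθ (aup Y₁ t₁ s₁) (.inl (.inl (.inl rfl))))
        (hθ (aup Y₂ t₂ s₂) (.inl (.inl (.inr rfl))))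
    · intro θ hθ
      exact .lams_bin (hdec.eqMod hE).2 (hθ (aup Y₁ t₁ s₁) (.inl (.inl (.inl rfl))))
        (hθ (aup Y₂ t₂ s₂) (.inl (.inl (.inr rfl))))
    · intro θ hθ
      rw [lams_msub]
      refine .of_lams fun Δ ρ hρ => ?_
      obtain ⟨r₁, hr₁, hp₁⟩ := IsPatternFun.genTerm
        (hθ (aup Y₁ t₁ s₁) (.inl (.inl (.inl rfl)))) (.etaVars ρ) hρ
      obtain ⟨r₂, hr₂, hp₂⟩ := IsPatternFun.genTerm
        (hθ (aup Y₂ t₂ s₂) (.inl (.inl (.inr rfl)))) (.etaVars ρ) hρ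
      exact ⟨.bin f r₁ r₂, Red.app (Red.app .refl hr₁) hr₂,
        .rigid (.app (.app (.const f) hp₁) hp₂)⟩

theorem Invariant.init {E : Set Ax} {P : AUP S} (hl : Nf .long P.lhs) (hr : Nf .long P.rhs) :
    Invariant E P ⟨{P}, ∅, Subst.id⟩ := by
  have hmem : P ∈ State.problems (S := S) ⟨{P}, ∅, Subst.id⟩ := .inl rfl
  have hid : ∀ θ : Subst S, (Subst.id P.var : Tm S [] P.var.ty).msub θ = θ P.var :=
    fun θ => Tm.ren_nil _ _
  refine ⟨?_, ?_, Set.finite_empty, fun _ h => h.elim, fun θ h => ?_, fun θ h => ?_,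
    fun θ h => ?_⟩
  · rintro P₁ (rfl | h₁) P₂ (rfl | h₂) _
    · rfl
    · exact h₂.elim
    · exact h₁.elim
    · exact h₁.elim
  · rintro P' (rfl | h)
    · exact ⟨hl, hr⟩
    · exact h.elim
  · exact (congrArg (fun p : Tm S [] P.var.ty => IsValue E P.lhs p) (hid θ)).mpr (h P hmem)
  · exact (congrArg (fun p : Tm S [] P.var.ty => IsValue E P.rhs p) (hid θ)).mpr (h P hmem)
  · exact (congrArg (fun p : Tm S [] P.var.ty => IsPatternFun P.ctx P.ty p) (hid θ)).mpr (h P hmem)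

/-- Values may be prescribed for the variables of finitely many problems with distinct
variables. -/
theorem exists_subst {T : Set (AUP S)} (hfin : T.Finite) (inj : Set.InjOn AUP.var T)
    (v : (P : AUP S) → Tm S [] P.var.ty) :
    ∃ θ : Subst S, θ.Dom.Finite ∧ ∀ P ∈ T, θ P.var = v P := by
  classical
  let θ : Subst S := fun w =>
    if h : ∃ P ∈ T, P.var = w then h.choose_spec.2 ▸ v h.choose else Subst.id w
  refine ⟨θ, (hfin.image AUP.var).subset fun w hw => ?_, fun P hP => ?_⟩
  · by_contra hn
    exact hw (dif_neg hn)
  · have h : ∃ P' ∈ T, P'.var = P.var := ⟨P, hP, rfl⟩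
    have e : θ P.var = h.choose_spec.2 ▸ v h.choose := dif_pos h
    have hc : h.choose = P := inj h.choose_spec.1 hP h.choose_spec.2
    rw [e]
    generalize h.choose_spec.2 = hv
    revert hv
    rw [hc]
    intro hv
    rfl

end HOAU

theorem mainTheorem2 {B : Type*} (S : HOAU.Signature B)
    (𝒢 : HOAU.Calculus) (E : Set HOAU.Ax) (hE : 𝒢.theory ⊆ E)
    {τ : HOAU.Ty B} (t s : HOAU.Tm S [] τ)
    (ht : t.IsLongNormal) (hs : s.IsLongNormal)
    (X : ℕ) (hXt : ¬ t.MOccurs ⟨τ, X⟩) (hXs : ¬ s.MOccurs ⟨τ, X⟩)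
    (R : Set (HOAU.AUP S)) (σ : HOAU.Subst S)
    (h : Relation.ReflTransGen (HOAU.Step 𝒢 E)
      ⟨{HOAU.aup X t s}, ∅, HOAU.Subst.id⟩ ⟨∅, R, σ⟩) :
    (∃ r : HOAU.Tm S [] τ, Relation.ReflTransGen HOAU.Beta (σ ⟨τ, X⟩) r ∧
      r.IsLongNormal ∧ r.IsPattern) ∧
    HOAU.MoreGeneral E (σ ⟨τ, X⟩) t ∧ HOAU.MoreGeneral E (σ ⟨τ, X⟩) s := by
  have inv : HOAU.Invariant E (HOAU.aup X t s) ⟨∅, R, σ⟩ := by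
    generalize (⟨∅, R, σ⟩ : HOAU.State S) = st at h
    induction h with
    | refl => exact .init ht hs
    | tail _ hst ih => exact hst.invariant hE ih
  have hstore : ∀ P ∈ HOAU.State.problems ⟨∅, R, σ⟩, P ∈ R := by
    rintro P (hP | hP)
    · exact hP.elim
    · exact hP
  have injR : Set.InjOn HOAU.AUP.var R := inv.inj.mono fun _ h => .inr h
  refine ⟨?_, ?_, ?_⟩
  · have hp := inv.pat HOAU.Subst.id fun P hP => by
      obtain ⟨Γ, τ', Y, t', s'⟩ := P
      obtain ⟨b, rfl⟩ : ∃ b, τ' = .base b := inv.base _ (hstore _ hP)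
      exact HOAU.isPatternFun_mvar Γ b Y
    obtain ⟨r, hr, hpat⟩ := hp (Δ := []) (fun _ x => x) fun _ _ _ h => h
    have e : ((σ ⟨τ, X⟩).msub HOAU.Subst.id).wkNil (Γ := []) = σ ⟨τ, X⟩ := by
      rw [HOAU.Tm.msub_id]
      exact HOAU.Tm.ren_nil _ _
    exact ⟨r, e ▸ hr, hpat.nf, hpat⟩
  · obtain ⟨θ, hfin, hθ⟩ := HOAU.exists_subst inv.finite injR fun P => HOAU.lams P.lhs
    refine ⟨θ, hfin, ?_⟩
    have hv := inv.lhs θ fun P hP => by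
      rw [hθ P (hstore P hP)]
      exact .lams (inv.nf P hP).1
    have := hv (Δ := []) fun _ x => x
    rw [HOAU.Tm.ren_id] at this
    exact (HOAU.Tm.ren_nil ((σ ⟨τ, X⟩).msub θ) HOAU.Ren.ofNil) ▸ this
  · obtain ⟨θ, hfin, hθ⟩ := HOAU.exists_subst inv.finite injR fun P => HOAU.lams P.rhs
    refine ⟨θ, hfin, ?_⟩
    have hv := inv.rhs θ fun P hP => by
      rw [hθ P (hstore P hP)]
      exact .lams (inv.nf P hP).2
    have := hv (Δ := []) fun _ x => x
    rw [HOAU.Tm.ren_id] at this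
    exact (HOAU.Tm.ren_nil ((σ ⟨τ, X⟩).msub θ) HOAU.Ren.ofNil) ▸ this
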